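/- Let $S^3=\mathrm{SU}(2)$, with a smooth global frame $E_1,E_2,E_3$ satisfying $[E_i,E_j]=-2\sum_k\epsilon_{ijk}E_k$ ($\epsilon$ the Levi-Civita symbol) and dual coframe $\omega^1,\omega^2,\omega^3$. Such frames exist: on the unit quaternions $E_i(q)=-q\,e_i$ is one, where $e_1,e_2,e_3$ are the imaginary units. Let $z$ be the $2\pi$-periodic coordinate of $S^1$, let $\phi,a_1,a_2,a_3$ be smooth positive functions on $S^1$, and on $S^1\times S^3$ consider $$g=\phi(z)^2dz^2+\sum_{i=1}^3a_i(z)^2\,\omega^i\otimes\omega^i ,\qquad E_0=\partial_z .$$ Let $\hat g_z=\sum_i a_i(z)^2\omega^i\otimes\omega^i$ be the fibre metric on $S^3$. Then $g_{\alpha\beta}=g(E_\alpha,E_\beta)$ vanishes for $\alpha\ne\beta$, and $g_{00}=\phi^2$, $g_{ii}=a_i^2$; put $g^{\alpha\alpha}=1/g_{\alpha\alpha}$. With $\nabla$ the Levi-Civita connection, let $\nabla_{E_\alpha}E_\beta=\sum_\gamma\Sigma_{\alpha\beta}^\gamma E_\gamma$, $\mathrm{Rm}(X,Y)Z=\nabla_X\nabla_YZ-\nabla_Y\nabla_XZ-\nabla_{[X,Y]}Z$,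 $\mathrm{Rm}_{\alpha\beta\gamma\delta}=g(\mathrm{Rm}(E_\alpha,E_\beta)E_\gamma,E_\delta)$, $\mathrm{Ric}(Y,Z)=\mathrm{tr}(X\mapsto \mathrm{Rm}(X,Y)Z)$, let $K_{\alpha\beta}$ be the sectional curvature of the plane spanned by $E_\alpha,E_\beta$, and let hats denote the same objects for $\hat g_z$ and $E_1,E_2,E_3$. Let $i,j,k\in\{1,2,3\}$. 1. Frame symbols, for all $i,j,k$: $\Sigma_{00}^0=\frac12g^{00}\partial_zg_{00}$; $\Sigma_{0i}^0=\Sigma_{i0}^0=\Sigma_{00}^i=0$; $\Sigma_{j0}^i=\Sigma_{0j}^i=\frac12\delta_{ij}\,g^{ii}\partial_zg_{ii}$; $\Sigma_{ij}^0=-\frac12\delta_{ij}\,g^{00}\partial_zg_{ii}$; $\Sigma_{ij}^k=\hat\Sigma_{ij}^k=\epsilon_{ijk}g^{kk}(g_{ii}-g_{jj}-g_{kk})$. 2. Riemann tensor, for distinct $i,j,k$: $\mathrm{Rm}_{0000}=\mathrm{Rm}_{000i}=0$; $\mathrm{Rm}_{i00j}=0$; $$\mathrm{Rm}_{i00i}=\mathrm{Rm}_{0ii0}=\tfrac14\big(g^{00}\partial_zg_{00}\partial_zg_{ii}+g^{ii}(\partial_zg_{ii})^2-2\partial_{zz}g_{ii}\big);$$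 $\mathrm{Rm}_{ijjk}=\mathrm{Rm}_{ijj0}=0$; $\mathrm{Rm}_{ijji}=-\frac14g^{00}\partial_zg_{jj}\partial_zg_{ii}+\hat{\mathrm{Rm}}_{ijji}$ with $\hat{\mathrm{Rm}}_{ijji}=-g^{kk}(g_{kk}^2-(g_{ii}-g_{jj})^2)-2(g_{kk}-g_{jj}-g_{ii})$. 3. Ricci tensor: $\mathrm{Ric}_{\alpha\beta}=0$ for $\alpha\neq\beta$, $$\mathrm{Ric}_{00}=\tfrac14\sum_{i=1}^3\big(g^{00}g^{ii}\partial_zg_{00}\partial_zg_{ii}+(g^{ii}\partial_zg_{ii})^2-2g^{ii}\partial_{zz}g_{ii}\big),$$ and $$\begin{aligned}\mathrm{Ric}_{ii}=\tfrac14\Big(&g^{00}\big(g^{00}\partial_zg_{00}\partial_zg_{ii}+g^{ii}(\partial_zg_{ii})^2-2\partial_{zz}g_{ii}\big)\\&-\sum_{j\ne i}g^{jj}\big(g^{00}\partial_zg_{jj}\partial_zg_{ii}+4g^{kk}(g_{kk}^2-(g_{ii}-g_{jj})^2)+8(g_{kk}-g_{jj}-g_{ii})\big)\Big),\end{aligned}$$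 where in the sum $j\in\{1,2,3\}$ and $k$ is the third index, $\{i,j,k\}=\{1,2,3\}$. 4. Sectional curvatures, for distinct $i,j,k$: $K_{0i}=\frac14g^{00}g^{ii}\big(g^{00}\partial_zg_{00}\partial_zg_{ii}+g^{ii}(\partial_zg_{ii})^2-2\partial_{zz}g_{ii}\big)$ and $K_{ij}=-\frac14g^{00}g^{ii}g^{jj}\partial_zg_{ii}\partial_zg_{jj}+\hat K_{ij}$ with $\hat K_{ij}=-g^{ii}g^{jj}\big(g^{kk}(g_{kk}^2-(g_{ii}-g_{jj})^2)+2(g_{kk}-g_{jj}-g_{ii})\big)$. 5. Ricci flow: let $\phi,a_1,a_2,a_3$ depend also on $t$ in a nondegenerate interval $J$, and at each $t\in J$ be smooth and positive on $S^1$. Write $'=\partial_s=\phi^{-1}\partial_z$. Then $g(t)=\phi^2dz^2+\sum_ia_i^2\,\omega^i\otimes\omega^i$ solves $\partial_tg=-2\,\mathrm{Ric}(g)$ on $J$ (time derivatives being one-sided at end points of $J$) if and only if on $S^1\times J$ $$\partial_t\log\phi=\frac{a_1''}{a_1}+\frac{a_2''}{a_2}+\frac{a_3''}{a_3},\qquad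 \partial_ta_i=a_i''+a_i'\Big(\frac{a_j'}{a_j}+\frac{a_k'}{a_k}\Big)-2a_i\,\frac{a_i^4-(a_j^2-a_k^2)^2}{(a_1a_2a_3)^2}\quad(\{i,j,k\}=\{1,2,3\}).$$ Along such a flow, $[\partial_t,\partial_s]f=-\Big(\frac{a_1''}{a_1}+\frac{a_2''}{a_2}+\frac{a_3''}{a_3}\Big)\partial_sf$ for every smooth $f$ on $J\times S^1$. -/

import Mathlib

open scoped Manifold ContDiff

noncomputable section

/-! ### Riemannian geometry on a manifold

A metric is given as a field of bilinear forms on the tangent spaces, a connection as an operator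
`cov` sending a vector field `Y` to the field of linear maps `v ↦ ∇_v Y`. -/

section Riemannian

variable {E : Type*} [NormedAddCommGroup E] [NormedSpace ℝ E]
  {H : Type*} [TopologicalSpace H] {I : ModelWithCorners ℝ E H}
  {M : Type*} [TopologicalSpace M] [ChartedSpace H M] [IsManifold I 1 M]

/-- Smooth (that is, `C^∞`) vector fields. -/
def SmoothField (X : (x : M) → TangentSpace I x) : Prop :=
  ContMDiff I I.tangent ∞ (fun x => (⟨x, X x⟩ : TangentBundle I M))

/-- `cov` is a Levi-Civita connection of `g`: a covariant derivative which is torsion free,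
`∇_X Y - ∇_Y X = [X, Y]`, and metric, `X g(Y, Z) = g(∇_X Y, Z) + g(Y, ∇_X Z)`. -/
structure IsLeviCivita (g : (x : M) → TangentSpace I x →L[ℝ] TangentSpace I x →L[ℝ] ℝ)
    (cov : ((x : M) → TangentSpace I x) → (x : M) → TangentSpace I x →L[ℝ] TangentSpace I x) :
    Prop where
  isCovariantDerivative : IsCovariantDerivativeOn E cov Set.univ
  torsion_free : ∀ X Y : (x : M) → TangentSpace I x, SmoothField X → SmoothField Y →
    ∀ x, cov Y x (X x) - cov X x (Y x) = VectorField.mlieBracket I X Y x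
  metric : ∀ X Y Z : (x : M) → TangentSpace I x, SmoothField X → SmoothField Y → SmoothField Z →
    ∀ x, mvfderiv I (fun y => g y (Y y) (Z y)) x (X x)
      = g x (cov Y x (X x)) (Z x) + g x (Y x) (cov Z x (X x))

/-- The Levi-Civita connection of `g`. -/
def leviCivita (g : (x : M) → TangentSpace I x →L[ℝ] TangentSpace I x →L[ℝ] ℝ) :
    ((x : M) → TangentSpace I x) → (x : M) → TangentSpace I x →L[ℝ] TangentSpace I x :=
  Classical.epsilon (IsLeviCivita g)

/-- `R` is the curvature tensor of the connection `cov`: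
`R(X, Y) Z = ∇_X ∇_Y Z - ∇_Y ∇_X Z - ∇_[X, Y] Z` for all smooth vector fields `X`, `Y`, `Z`. -/
def IsCurvatureTensor
    (cov : ((x : M) → TangentSpace I x) → (x : M) → TangentSpace I x →L[ℝ] TangentSpace I x)
    (R : (x : M) → TangentSpace I x →ₗ[ℝ] TangentSpace I x →ₗ[ℝ] TangentSpace I x →ₗ[ℝ]
      TangentSpace I x) : Prop :=
  ∀ X Y Z : (x : M) → TangentSpace I x, SmoothField X → SmoothField Y → SmoothField Z →
    ∀ x, R x (X x) (Y x) (Z x)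
      = cov (fun y => cov Z y (Y y)) x (X x) - cov (fun y => cov Z y (X y)) x (Y x)
        - cov Z x (VectorField.mlieBracket I X Y x)

/-- The Riemann curvature tensor of `g`, as the field of trilinear maps `(u, v, w) ↦ R(u, v) w`. -/
def curvature (g : (x : M) → TangentSpace I x →L[ℝ] TangentSpace I x →L[ℝ] ℝ) :
    (x : M) → TangentSpace I x →ₗ[ℝ] TangentSpace I x →ₗ[ℝ] TangentSpace I x →ₗ[ℝ]
      TangentSpace I x :=
  Classical.epsilon (IsCurvatureTensor (leviCivita g))

/-- `Rm(u, v, w, y) = g(R(u, v) w, y)`. -/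
def Rm (g : (x : M) → TangentSpace I x →L[ℝ] TangentSpace I x →L[ℝ] ℝ) (x : M)
    (u v w y : TangentSpace I x) : ℝ :=
  g x (curvature g x u v w) y

/-- The Ricci tensor: `Ric(v, w)` is the trace of `u ↦ R(u, v) w`. -/
def ricci (g : (x : M) → TangentSpace I x →L[ℝ] TangentSpace I x →L[ℝ] ℝ) (x : M)
    (v w : TangentSpace I x) : ℝ :=
  LinearMap.trace ℝ (TangentSpace I x)
    ((LinearMap.applyₗ w).comp ((curvature g x).flip v))

/-- The sectional curvature of the plane spanned by `u` and `v`. -/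
def sectional (g : (x : M) → TangentSpace I x →L[ℝ] TangentSpace I x →L[ℝ] ℝ) (x : M)
    (u v : TangentSpace I x) : ℝ :=
  Rm g x u v v u / (g x u u * g x v v - g x u v ^ 2)

/-- The symbols of `g` in a frame `e` with dual coframe `θ`:
`∇_{e α} (e β) = ∑ γ, frameSymbol g e θ x α β γ • e γ`. -/
def frameSymbol {ι : Type*} (g : (x : M) → TangentSpace I x →L[ℝ] TangentSpace I x →L[ℝ] ℝ)
    (e : ι → (x : M) → TangentSpace I x) (θ : ι → (x : M) → TangentSpace I x →L[ℝ] ℝ)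
    (x : M) (α β γ : ι) : ℝ :=
  θ γ x (leviCivita g (e β) x (e α x))

/-- `g t`, `t ∈ J`, solves the Ricci flow `∂_t g = -2 Ric(g)`. -/
def IsRicciFlowOn (J : Set ℝ)
    (g : ℝ → (x : M) → TangentSpace I x →L[ℝ] TangentSpace I x →L[ℝ] ℝ) : Prop :=
  ∀ t ∈ J, ∀ (x : M) (v w : TangentSpace I x),
    HasDerivWithinAt (fun τ => g τ x v w) (-2 * ricci (g t) x v w) J t

end Riemannian

/-! ### The circle -/

/-- The vector field `∂_z` on the circle `{e^{iz}}`: at `p` it is the velocity of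
`t ↦ p e^{it}` at `t = 0`. -/
def circleField (p : Circle) : TangentSpace (𝓡 1) p :=
  (show p * Circle.exp 0 = p by simp) ▸
    (mfderiv 𝓘(ℝ, ℝ) (𝓡 1) (fun t : ℝ => p * Circle.exp t) 0 (1 : ℝ) :
      TangentSpace (𝓡 1) (p * Circle.exp 0))

/-- The one-form `dz` on the circle: a tangent vector of the form `c • (i p)` at `p ∈ ℂ` is sent
to `c`. -/
def circleForm (p : Circle) : TangentSpace (𝓡 1) p →L[ℝ] ℝ :=
  (innerSL ℝ (Complex.I * (p : ℂ))).comp (mvfderiv (𝓡 1) (fun x : Circle => (x : ℂ)) p)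

/-- The derivative `∂_z f` of a function on the circle. -/
def ddz (f : Circle → ℝ) (p : Circle) : ℝ := deriv (fun t : ℝ => f (p * Circle.exp t)) 0

/-- The arclength derivative `∂_s f = φ⁻¹ ∂_z f`. -/
def dds (φ f : Circle → ℝ) (p : Circle) : ℝ := (φ p)⁻¹ * ddz f p

/-- The time derivative `∂_t f` of a time-dependent function on the circle, for times in `J`. -/
def ddt (J : Set ℝ) (f : ℝ → Circle → ℝ) (t : ℝ) (p : Circle) : ℝ :=
  derivWithin (fun τ => f τ p) J t

/-! ### The three-sphere -/

instance quaternionFinrankFact : Fact (Module.finrank ℝ (Quaternion ℝ) = 3 + 1) :=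
  ⟨Quaternion.finrank_eq_four⟩

/-- `S³ = SU(2)`, as the unit sphere of the quaternions. -/
abbrev S3 : Type := Metric.sphere (0 : Quaternion ℝ) 1

/-- The imaginary units of the quaternions. -/
def imUnit : Fin 3 → Quaternion ℝ := ![⟨0, 1, 0, 0⟩, ⟨0, 0, 1, 0⟩, ⟨0, 0, 0, 1⟩]

/-- The Levi-Civita symbol, with `eps 0 1 2 = 1`. -/
def eps (i j k : Fin 3) : ℝ :=
  ((j.val : ℝ) - i.val) * ((k.val : ℝ) - j.val) * ((k.val : ℝ) - i.val) / 2

/-- A smooth global frame `E_1, E_2, E_3` of `S³` with `[E_i, E_j] = -2 ∑ k, ε_{ijk} E_k`, together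
with its dual coframe `ω^1, ω^2, ω^3`. -/
structure MilnorFrame where
  frame : Fin 3 → (q : S3) → TangentSpace (𝓡 3) q
  coframe : Fin 3 → (q : S3) → TangentSpace (𝓡 3) q →L[ℝ] ℝ
  smooth : ∀ i, SmoothField (frame i)
  dual : ∀ i j q, coframe i q (frame j q) = if i = j then 1 else 0
  bracket : ∀ i j q, VectorField.mlieBracket (𝓡 3) (frame i) (frame j) q
    = (-2 : ℝ) • ∑ k, eps i j k • frame k q

/-- The metric `∑ i, (c i)² ω^i ⊗ ω^i` on `S³`. -/
def fibreMetric (F : MilnorFrame) (c : Fin 3 → ℝ) (q : S3) :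
    TangentSpace (𝓡 3) q →L[ℝ] TangentSpace (𝓡 3) q →L[ℝ] ℝ :=
  ∑ i, c i ^ 2 • (F.coframe i q).smulRight (F.coframe i q)

/-! ### The product `S¹ × S³` -/

/-- The frame `∂_z, E_1, E_2, E_3` on `S¹ × S³`. -/
def prodFrame (F : MilnorFrame) :
    Fin 4 → (x : Circle × S3) → TangentSpace ((𝓡 1).prod (𝓡 3)) x :=
  Fin.cons
    (fun x => mfderiv (𝓡 1) ((𝓡 1).prod (𝓡 3)) (fun p : Circle => (p, x.2)) x.1
      (circleField x.1))
    (fun i x => mfderiv (𝓡 3) ((𝓡 1).prod (𝓡 3)) (fun q : S3 => (x.1, q)) x.2 (F.frame i x.2))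

/-- The coframe `dz, ω^1, ω^2, ω^3` on `S¹ × S³`. -/
def prodCoframe (F : MilnorFrame) :
    Fin 4 → (x : Circle × S3) → TangentSpace ((𝓡 1).prod (𝓡 3)) x →L[ℝ] ℝ :=
  Fin.cons
    (fun x => (circleForm x.1).comp
      (mfderiv ((𝓡 1).prod (𝓡 3)) (𝓡 1) (Prod.fst : Circle × S3 → Circle) x))
    (fun i x => (F.coframe i x.2).comp
      (mfderiv ((𝓡 1).prod (𝓡 3)) (𝓡 3) (Prod.snd : Circle × S3 → S3) x))

/-- `φ, a 0, a 1, a 2` are smooth positive functions on the circle. -/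
structure IsAnsatz (φ : Circle → ℝ) (a : Fin 3 → Circle → ℝ) : Prop where
  smooth_φ : ContMDiff (𝓡 1) 𝓘(ℝ, ℝ) ∞ φ
  smooth_a : ∀ i, ContMDiff (𝓡 1) 𝓘(ℝ, ℝ) ∞ (a i)
  pos_φ : ∀ p, 0 < φ p
  pos_a : ∀ i p, 0 < a i p

/-- The metric components `g_{00} = φ²` and `g_{ii} = (a i)²`, as functions of `z ∈ S¹`. -/
def gLow (φ : Circle → ℝ) (a : Fin 3 → Circle → ℝ) : Fin 4 → Circle → ℝ :=
  Fin.cons (fun p => φ p ^ 2) (fun i p => a i p ^ 2)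

/-- The inverse components `g^{αα} = 1 / g_{αα}`. -/
def gUp (φ : Circle → ℝ) (a : Fin 3 → Circle → ℝ) (α : Fin 4) (p : Circle) : ℝ :=
  (gLow φ a α p)⁻¹

/-- The metric `φ² dz² + ∑ i, (a i)² ω^i ⊗ ω^i` on `S¹ × S³`. -/
def ansatzMetric (F : MilnorFrame) (φ : Circle → ℝ) (a : Fin 3 → Circle → ℝ) (x : Circle × S3) :
    TangentSpace ((𝓡 1).prod (𝓡 3)) x →L[ℝ] TangentSpace ((𝓡 1).prod (𝓡 3)) x →L[ℝ] ℝ :=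
  φ x.1 ^ 2 • (prodCoframe F 0 x).smulRight (prodCoframe F 0 x)
    + ∑ i : Fin 3, a i x.1 ^ 2 • (prodCoframe F i.succ x).smulRight (prodCoframe F i.succ x)

/-! ### Components in the frame `∂_z, E_1, E_2, E_3`

The index `0` stands for `∂_z` and the index `i.succ` for `E_i`; a hat denotes the fibre metric. -/

/-- The symbols `Σ_{αβ}^γ`. -/
def Sig (F : MilnorFrame) (φ : Circle → ℝ) (a : Fin 3 → Circle → ℝ) (x : Circle × S3)
    (α β γ : Fin 4) : ℝ :=
  frameSymbol (ansatzMetric F φ a) (prodFrame F) (prodCoframe F) x α β γ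

/-- The curvature components `Rm_{αβγδ}`. -/
def RmC (F : MilnorFrame) (φ : Circle → ℝ) (a : Fin 3 → Circle → ℝ) (x : Circle × S3)
    (α β γ δ : Fin 4) : ℝ :=
  Rm (ansatzMetric F φ a) x (prodFrame F α x) (prodFrame F β x) (prodFrame F γ x) (prodFrame F δ x)

/-- The Ricci components `Ric_{αβ}`. -/
def RicC (F : MilnorFrame) (φ : Circle → ℝ) (a : Fin 3 → Circle → ℝ) (x : Circle × S3)
    (α β : Fin 4) : ℝ :=
  ricci (ansatzMetric F φ a) x (prodFrame F α x) (prodFrame F β x)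

/-- The sectional curvatures `K_{αβ}`. -/
def KC (F : MilnorFrame) (φ : Circle → ℝ) (a : Fin 3 → Circle → ℝ) (x : Circle × S3)
    (α β : Fin 4) : ℝ :=
  sectional (ansatzMetric F φ a) x (prodFrame F α x) (prodFrame F β x)

/-- The symbols of the fibre metric. -/
def SigHat (F : MilnorFrame) (c : Fin 3 → ℝ) (q : S3) (i j k : Fin 3) : ℝ :=
  frameSymbol (fibreMetric F c) F.frame F.coframe q i j k

/-- The curvature components of the fibre metric. -/
def RmHat (F : MilnorFrame) (c : Fin 3 → ℝ) (q : S3) (i j k l : Fin 3) : ℝ :=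
  Rm (fibreMetric F c) q (F.frame i q) (F.frame j q) (F.frame k q) (F.frame l q)

/-- The sectional curvatures of the fibre metric. -/
def KHat (F : MilnorFrame) (c : Fin 3 → ℝ) (q : S3) (i j : Fin 3) : ℝ :=
  sectional (fibreMetric F c) q (F.frame i q) (F.frame j q)

end

/-!
The metric `φ² dz² + ∑ i, a_i² ω^i ⊗ ω^i` is diagonal in the global frame `∂_z, E_1, E_2, E_3`,
whose structure functions are constant. In such a frame every object of the statement is given by an
explicit formula, and the theorem comes down to evaluating these formulas.

The general part concerns a smooth global frame `e` with dual coframe `θ` on a manifold, with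
constant structure constants, and a metric `∑ α, G α • θ^α ⊗ θ^α`. The Koszul formula determines the
symbols of any Levi-Civita connection (`IsDualFrame.symbols_eq_koszul`), and conversely the
connection with these symbols is a Levi-Civita connection (`IsDualFrame.isLeviCivita_frameConn`); so
the connection chosen by `leviCivita` agrees with it on smooth fields. The structure equation
`Ω = dω + ω ∧ ω` then shows that the curvature expression is tensorial with components `curvComp`
(`IsDualFrame.coeff_curvature`), so that curvature tensors exist, and `curvature` has these
components. The second derivatives in this computation cancel because the Lie bracket acts on
functions as a commutator (`SmoothField.mvfderiv_mlieBracket`), a fact read off from the Jacobi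
identity for the bracket of vector fields. The same commutator formula, applied to the embeddings of
`S¹` in `ℂ` and of `S³` in the quaternions, gives the bracket relations of the left-invariant frame
on `S³` (`mlieBracket_sphereField`) and of the product frame (`mlieBracket_prodFrame`).

On `S¹ × S³` the components of the metric depend on `z` only, so the symbols and the curvature
become the algebraic expressions `warpSymbol` and `warpCurv` in the components and their first two
`z`-derivatives (`IsAnsatz.koszul_eq`, `IsAnsatz.curvComp_eq`), which are evaluated index by index.

Since the Ricci tensor is diagonal, the Ricci flow is equivalent to `∂_t g_{αα} = -2 Ric_{αα}`
(`isRicciFlowOn_iff_gLow`), which by positivity is a system for `log φ` and the `a_i`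
(`isRicciFlowOn_iff`). The commutator of `∂_t` and `∂_s = φ⁻¹ ∂_z` follows from the evolution of
`log φ` and the symmetry of second derivatives on `J × S¹` (`commutator_ddt_dds`).
-/

open scoped Manifold ContDiff

noncomputable section

open scoped Topology
open Bundle VectorField

/-! ### Smooth frames and dual coframes -/

section GlobalFrame

variable {E : Type*} [NormedAddCommGroup E] [NormedSpace ℝ E]
  {H : Type*} [TopologicalSpace H] {I : ModelWithCorners ℝ E H}
  {M : Type*} [TopologicalSpace M] [ChartedSpace H M]

theorem ContMDiff.mdiffAt {f : M → ℝ} (hf : ContMDiff I 𝓘(ℝ, ℝ) ∞ f) (x : M) : MDiffAt f x :=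
  (hf x).mdifferentiableAt (by simp)

theorem mdifferentiableAt_fun_sum {κ : Type*} {s : Finset κ} {f : κ → M → ℝ} {x : M}
    (hf : ∀ k ∈ s, MDiffAt (f k) x) : MDiffAt (fun y => ∑ k ∈ s, f k y) x := by
  classical
  induction s using Finset.induction_on with
  | empty => simpa using mdifferentiableAt_const
  | insert a s ha ih =>
    simp only [Finset.sum_insert ha]
    exact (hf a (by simp)).add (ih fun k hk => hf k (by simp [hk]))

theorem mvfderiv_fun_sum {κ : Type*} {s : Finset κ} {f : κ → M → ℝ} {x : M}
    (hf : ∀ k ∈ s, MDiffAt (f k) x) :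
    mvfderiv I (fun y => ∑ k ∈ s, f k y) x = ∑ k ∈ s, mvfderiv I (f k) x := by
  classical
  induction s using Finset.induction_on with
  | empty => simpa using mvfderiv_const (0 : ℝ)
  | insert a s ha ih =>
    simp only [Finset.sum_insert ha]
    rw [mvfderiv_fun_add (hf a (by simp))
        (mdifferentiableAt_fun_sum fun k hk => hf k (by simp [hk])),
      ih fun k hk => hf k (by simp [hk])]

/-- The metric `∑ α, G α • θ^α ⊗ θ^α`. -/
def frameMetric {κ : Type*} [Fintype κ] (θ : κ → (x : M) → TangentSpace I x →L[ℝ] ℝ)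
    (G : κ → M → ℝ) (x : M) : TangentSpace I x →L[ℝ] TangentSpace I x →L[ℝ] ℝ :=
  ∑ α, G α x • (θ α x).smulRight (θ α x)

theorem frameMetric_apply {κ : Type*} [Fintype κ]
    (θ : κ → (x : M) → TangentSpace I x →L[ℝ] ℝ) (G : κ → M → ℝ) (x : M) (v w : TangentSpace I x) :
    frameMetric θ G x v w = ∑ α, G α x * θ α x v * θ α x w := by
  simp [frameMetric, mul_assoc]

variable [IsManifold I ∞ M] {ι : Type*} [Fintype ι] [DecidableEq ι]

/-- A smooth global frame `e` of the tangent bundle together with its dual coframe `θ`. Smoothness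
of the coframe is a consequence, see `IsDualFrame.contMDiff_coeff`. -/
structure IsDualFrame (e : ι → (x : M) → TangentSpace I x)
    (θ : ι → (x : M) → TangentSpace I x →L[ℝ] ℝ) : Prop where
  smooth : ∀ i, SmoothField (e i)
  dual : ∀ i j x, θ i x (e j x) = if i = j then 1 else 0
  expand : ∀ (x : M) (v : TangentSpace I x), ∑ i, θ i x v • e i x = v

/-- The dual frame axioms without the expansion property suffice when the number of fields is the
dimension. -/
theorem IsDualFrame.of_card [FiniteDimensional ℝ E] {e : ι → (x : M) → TangentSpace I x}
    {θ : ι → (x : M) → TangentSpace I x →L[ℝ] ℝ} (hs : ∀ i, SmoothField (e i))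
    (hd : ∀ i j x, θ i x (e j x) = if i = j then 1 else 0)
    (hc : Fintype.card ι = Module.finrank ℝ E) : IsDualFrame e θ where
  smooth := hs
  dual := hd
  expand x v := by
    have : FiniteDimensional ℝ (TangentSpace I x) := inferInstanceAs (FiniteDimensional ℝ E)
    have hli : LinearIndependent ℝ (fun i => e i x) := by
      rw [Fintype.linearIndependent_iff]
      intro g hg i
      have := congrArg (θ i x) hg
      simpa [map_sum, hd] using this
    let b := basisOfLinearIndependentOfCardEqFinrank' _ hli hc
    have hb : ∀ i, b i = e i x := fun i =>
      congrFun (coe_basisOfLinearIndependentOfCardEqFinrank' _ hli hc) i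
    have := b.sum_repr v
    conv_rhs => rw [← this]
    refine Finset.sum_congr rfl fun i _ => ?_
    rw [hb]
    congr 1
    conv_lhs => rw [← this]
    simp [map_sum, hb, hd]

theorem SmoothField.mdiff {X : (x : M) → TangentSpace I x} (hX : SmoothField X) (x : M) :
    MDiffAt (fun y => (⟨y, X y⟩ : TangentBundle I M)) x :=
  (hX x).mdifferentiableAt (by simp)

/-- Near each point, the coframe is a smooth family of linear forms composed with the trivialization
of the tangent bundle: the matrix of the frame in the trivialization is smooth and invertible. -/
theorem IsDualFrame.exists_local_coframe [FiniteDimensional ℝ E]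
    {e : ι → (x : M) → TangentSpace I x}
    {θ : ι → (x : M) → TangentSpace I x →L[ℝ] ℝ} (h : IsDualFrame e θ) (x₀ : M) :
    ∃ B : M → E →L[ℝ] (ι → ℝ), ContMDiffAt I 𝓘(ℝ, E →L[ℝ] (ι → ℝ)) ∞ B x₀ ∧
      ∀ᶠ y in 𝓝 x₀, ∀ (i : ι) (v : TangentSpace I y), θ i y v =
        B y (trivializationAt E (TangentSpace I) x₀ ⟨y, v⟩).2 i := by
  set t := trivializationAt E (TangentSpace I : M → Type _) x₀
  -- the frame, read in the trivialization, as a family of linear maps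
  let A : M → (ι → ℝ) →L[ℝ] E := fun y =>
    ∑ i, (ContinuousLinearMap.proj (R := ℝ) (φ := fun _ : ι => ℝ) i).smulRight (t ⟨y, e i y⟩).2
  have hA : ContMDiffAt I 𝓘(ℝ, (ι → ℝ) →L[ℝ] E) ∞ A x₀ := by
    refine ContMDiffAt.sum fun i _ => ?_
    have h1 : ContMDiffAt I 𝓘(ℝ, E) ∞ (fun y => (t ⟨y, e i y⟩).2) x₀ :=
      (contMDiffAt_section x₀).1 (h.smooth i x₀)
    exact ((ContinuousLinearMap.smulRightL ℝ (ι → ℝ) E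
      (ContinuousLinearMap.proj i)).contDiff.contMDiff.contMDiffAt).comp x₀ h1
  have hbase : ∀ᶠ y in 𝓝 x₀, y ∈ t.baseSet :=
    t.open_baseSet.mem_nhds (FiberBundle.mem_baseSet_trivializationAt' x₀)
  -- at each point of the base set `A y` is invertible, with inverse given by the coframe
  have hinv : ∀ y ∈ t.baseSet, ∃ f : (ι → ℝ) ≃L[ℝ] E, (f : (ι → ℝ) →L[ℝ] E) = A y ∧
      ∀ (i : ι) (v : TangentSpace I y), f.symm (t ⟨y, v⟩).2 i = θ i y v := by
    intro y hy
    let L := t.continuousLinearEquivAt ℝ y hy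
    let f0 : (ι → ℝ) →L[ℝ] TangentSpace I y :=
      ∑ i, (ContinuousLinearMap.proj (R := ℝ) (φ := fun _ : ι => ℝ) i).smulRight (e i y)
    let g0 : TangentSpace I y →L[ℝ] (ι → ℝ) := ContinuousLinearMap.pi fun i => θ i y
    have h1 : ∀ v, f0 (g0 v) = v := fun v => by simpa [f0, g0] using h.expand y v
    have h2 : ∀ c, g0 (f0 c) = c := fun c => by
      ext i; simp [f0, g0, map_sum, h.dual]
    let f1 : (ι → ℝ) ≃L[ℝ] TangentSpace I y := ContinuousLinearEquiv.equivOfInverse f0 g0 h2 h1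
    refine ⟨f1.trans L, ?_, ?_⟩
    · ext1 c
      simp [f1, f0, A, L, map_sum]
    · intro i v
      have : (t ⟨y, v⟩).2 = L v := by simp [L]
      rw [this]
      simp [f1, g0]
  refine ⟨fun y => (A y).inverse, ?_, ?_⟩
  · obtain ⟨f, hf, -⟩ := hinv x₀ (FiberBundle.mem_baseSet_trivializationAt' x₀)
    have : CompleteSpace E := FiniteDimensional.complete ℝ E
    have : ContDiffAt ℝ ∞ ContinuousLinearMap.inverse (A x₀) := by
      rw [← hf]; exact contDiffAt_map_inverse f
    exact this.contMDiffAt.comp x₀ hA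
  · filter_upwards [hbase] with y hy i v
    obtain ⟨f, hf, hf'⟩ := hinv y hy
    rw [← hf' i v, ← hf, ContinuousLinearMap.inverse_equiv]
    rfl

theorem IsDualFrame.contMDiff_coeff [FiniteDimensional ℝ E]
    {e : ι → (x : M) → TangentSpace I x}
    {θ : ι → (x : M) → TangentSpace I x →L[ℝ] ℝ} (h : IsDualFrame e θ)
    {X : (x : M) → TangentSpace I x} (hX : SmoothField X) (i : ι) :
    ContMDiff I 𝓘(ℝ, ℝ) ∞ (fun y => θ i y (X y)) := by
  intro x₀
  obtain ⟨B, hB, hθ⟩ := h.exists_local_coframe x₀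
  have h1 := (contMDiffAt_section x₀).1 (hX x₀)
  have h2 := contMDiffAt_pi_space.1 (hB.clm_apply h1) i
  refine h2.congr_of_eventuallyEq ?_
  filter_upwards [hθ] with y hy
  exact hy i (X y)

theorem IsDualFrame.mdifferentiableAt_coeff [FiniteDimensional ℝ E]
    {e : ι → (x : M) → TangentSpace I x}
    {θ : ι → (x : M) → TangentSpace I x →L[ℝ] ℝ} (h : IsDualFrame e θ)
    {X : (x : M) → TangentSpace I x} {x₀ : M}
    (hX : MDiffAt (fun y => (⟨y, X y⟩ : TangentBundle I M)) x₀) (i : ι) :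
    MDiffAt (fun y => θ i y (X y)) x₀ := by
  obtain ⟨B, hB, hθ⟩ := h.exists_local_coframe x₀
  have h1 := (mdifferentiableAt_section I X).1 hX
  have h2 := (hB.mdifferentiableAt (by simp)).clm_apply h1
  have h3 : MDiffAt (fun y => B y (trivializationAt E (TangentSpace I) x₀ ⟨y, X y⟩).2 i) x₀ :=
    (ContinuousLinearMap.proj (R := ℝ) (φ := fun _ : ι => ℝ)
      i).differentiableAt.mdifferentiableAt.comp x₀ h2
  refine h3.congr_of_eventuallyEq ?_
  filter_upwards [hθ] with y hy
  exact hy i (X y)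

end GlobalFrame

/-! ### The Lie bracket as a commutator of derivations -/

section GlobalFrame

variable {E : Type*} [NormedAddCommGroup E] [NormedSpace ℝ E]
  {H : Type*} [TopologicalSpace H] {I : ModelWithCorners ℝ E H}
  {M : Type*} [TopologicalSpace M] [ChartedSpace H M] [IsManifold I ∞ M]

theorem SmoothField.smul {f : M → ℝ} {X : (x : M) → TangentSpace I x}
    (hf : ContMDiff I 𝓘(ℝ, ℝ) ∞ f) (hX : SmoothField X) : SmoothField (f • X) :=
  ContMDiff.smul_section hf hX

theorem SmoothField.sum {κ : Type*} {s : Finset κ} {X : κ → (x : M) → TangentSpace I x}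
    (hX : ∀ k ∈ s, SmoothField (X k)) : SmoothField (fun x => ∑ k ∈ s, X k x) :=
  ContMDiff.sum_section hX

theorem SmoothField.mlieBracket [CompleteSpace E] {X Y : (x : M) → TangentSpace I x}
    (hX : SmoothField X) (hY : SmoothField Y) : SmoothField (VectorField.mlieBracket I X Y) :=
  fun x => by
    have : IsManifold I (((⊤ : ℕ∞) : ℕ∞ω) + 1) M := ‹IsManifold I ∞ M›
    have : IsManifold I (minSmoothness ℝ 2) M := by
      rw [minSmoothness_of_isRCLikeNormedField]; infer_instance
    exact ContMDiffAt.mlieBracket_vectorField (m := ⊤) (n := ⊤) (hX x) (hY x) (by simp)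

theorem SmoothField.contMDiff_mvfderiv {F : Type*} [NormedAddCommGroup F] [NormedSpace ℝ F]
    {f : M → F} {X : (x : M) → TangentSpace I x}
    (hf : ContMDiff I 𝓘(ℝ, F) ∞ f) (hX : SmoothField X) :
    ContMDiff I 𝓘(ℝ, F) ∞ (fun x => mvfderiv I f x (X x)) := by
  have h1 := (hf.contMDiff_tangentMap (m := ∞) (by simp)).comp hX
  exact (contMDiff_snd_tangentBundle_modelSpace F 𝓘(ℝ, F)).comp h1

/-- The Lie bracket is the commutator of derivations: `X (Y f) - Y (X f) = [X, Y] f`. This is the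
coefficient of `Z` in the Jacobi identity for `X`, `Y` and `f • Z`, which is where the auxiliary
field `Z` with `Z x ≠ 0` comes from; in the presence of a frame it can be any field of the frame. -/
theorem SmoothField.mvfderiv_mlieBracket [CompleteSpace E] {X Y Z : (x : M) → TangentSpace I x}
    (hX : SmoothField X) (hY : SmoothField Y) (hZ : SmoothField Z) {x : M} (hZx : Z x ≠ 0)
    {f : M → ℝ} (hf : ContMDiff I 𝓘(ℝ, ℝ) ∞ f) :
    mvfderiv I f x (VectorField.mlieBracket I X Y x)
      = mvfderiv I (fun y => mvfderiv I f y (Y y)) x (X x)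
        - mvfderiv I (fun y => mvfderiv I f y (X y)) x (Y x) := by
  -- `[X, [Y, f Z]]`, by the Leibniz rule for the bracket
  have key : ∀ X Y : (x : M) → TangentSpace I x, SmoothField X → SmoothField Y →
      VectorField.mlieBracket I X (VectorField.mlieBracket I Y (f • Z)) x
        = mvfderiv I (fun y => mvfderiv I f y (Y y)) x (X x) • Z x
          + mvfderiv I f x (Y x) • VectorField.mlieBracket I X Z x
          + mvfderiv I f x (X x) • VectorField.mlieBracket I Y Z x
          + f x • VectorField.mlieBracket I X (VectorField.mlieBracket I Y Z) x := by
    intro X Y hX hY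
    have h1 : VectorField.mlieBracket I Y (f • Z)
        = (fun y => mvfderiv I f y (Y y)) • Z + f • VectorField.mlieBracket I Y Z := by
      funext y
      exact mlieBracket_smul_right (hf.mdiffAt y) (hZ.mdiff y)
    have hYf := hY.contMDiff_mvfderiv hf
    rw [h1, mlieBracket_add_right ((hZ.smul hYf).mdiff x) (((hY.mlieBracket hZ).smul hf).mdiff x),
      mlieBracket_smul_right (hYf.mdiffAt x) (hZ.mdiff x),
      mlieBracket_smul_right (hf.mdiffAt x) ((hY.mlieBracket hZ).mdiff x)]
    abel
  have h2 : minSmoothness ℝ 2 = 2 := by simp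
  have hle : ∀ {W : (x : M) → TangentSpace I x}, SmoothField W →
      ContMDiffAt I I.tangent (minSmoothness ℝ 2) (fun x => (⟨x, W x⟩ : TangentBundle I M)) x :=
    fun hW => (hW x).of_le
      (by rw [h2]; exact (mod_cast le_top : ((2 : ℕ∞) : ℕ∞ω) ≤ ((⊤ : ℕ∞) : ℕ∞ω)))
  have : IsManifold I (minSmoothness ℝ 3) M := by
    rw [minSmoothness_of_isRCLikeNormedField]; infer_instance
  have jac := leibniz_identity_mlieBracket_apply (hle hX) (hle hY) (hle (hZ.smul hf))
  have jac0 := leibniz_identity_mlieBracket_apply (hle hX) (hle hY) (hle hZ)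
  rw [key X Y hX hY, key Y X hY hX, mlieBracket_smul_right (hf.mdiffAt x) (hZ.mdiff x), jac0] at jac
  have : (mvfderiv I f x (VectorField.mlieBracket I X Y x)
      - (mvfderiv I (fun y => mvfderiv I f y (Y y)) x (X x)
        - mvfderiv I (fun y => mvfderiv I f y (X y)) x (Y x))) • Z x = 0 := by
    rw [← sub_eq_zero] at jac
    rw [← neg_eq_zero, ← jac]
    module
  exact sub_eq_zero.1 ((smul_eq_zero.1 this).resolve_right hZx)

end GlobalFrame

/-! ### Connections given by their symbols in a frame -/

section GlobalFrame

variable {E : Type*} [NormedAddCommGroup E] [NormedSpace ℝ E]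
  {H : Type*} [TopologicalSpace H] {I : ModelWithCorners ℝ E H}
  {M : Type*} [TopologicalSpace M] [ChartedSpace H M]
variable [IsManifold I ∞ M] {ι : Type*} [Fintype ι] [DecidableEq ι]
variable {e : ι → (x : M) → TangentSpace I x} {θ : ι → (x : M) → TangentSpace I x →L[ℝ] ℝ}

theorem IsDualFrame.ext (h : IsDualFrame e θ) {x : M} {v w : TangentSpace I x}
    (hvw : ∀ i, θ i x v = θ i x w) : v = w := by
  rw [← h.expand x v, ← h.expand x w]
  simp only [hvw]

theorem IsDualFrame.coeff_sum (h : IsDualFrame e θ) (x : M) (c : ι → ℝ) (i : ι) :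
    θ i x (∑ j, c j • e j x) = c i := by
  simp [map_sum, h.dual]

theorem IsDualFrame.smoothField_of_coeff (h : IsDualFrame e θ)
    {X : (x : M) → TangentSpace I x}
    (hX : ∀ i, ContMDiff I 𝓘(ℝ, ℝ) ∞ (fun y => θ i y (X y))) : SmoothField X := by
  have : X = fun x => ∑ i, ((fun y => θ i y (X y)) • e i) x := by
    funext x; exact (h.expand x (X x)).symm
  rw [this]
  exact SmoothField.sum fun i _ => (h.smooth i).smul (hX i)

theorem IsDualFrame.frame_ne_zero (h : IsDualFrame e θ) (i : ι) (x : M) : e i x ≠ 0 := by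
  intro h0
  have := h.dual i i x
  simp [h0] at this

theorem mlieBracket_sum_right [CompleteSpace E] {κ : Type*} {s : Finset κ}
    {X : (x : M) → TangentSpace I x} {Y : κ → (x : M) → TangentSpace I x}
    (hY : ∀ k ∈ s, SmoothField (Y k)) (x : M) :
    VectorField.mlieBracket I X (fun y => ∑ k ∈ s, Y k y) x
      = ∑ k ∈ s, VectorField.mlieBracket I X (Y k) x := by
  classical
  induction s using Finset.induction_on with
  | empty =>
    simp only [Finset.sum_empty]
    exact congrFun mlieBracket_zero_right x
  | insert a s ha ih =>
    have h1 : (fun y => ∑ k ∈ insert a s, Y k y) = Y a + fun y => ∑ k ∈ s, Y k y := by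
      funext y; simp [Finset.sum_insert ha]
    have h2 : ∀ k ∈ s, SmoothField (Y k) := fun k hk => hY k (by simp [hk])
    rw [h1, mlieBracket_add_right ((hY a (by simp)).mdiff x) ((SmoothField.sum h2).mdiff x),
      Finset.sum_insert ha, ih h2]

/-- The coefficients of a Lie bracket in a frame with structure constants `c`. -/
theorem IsDualFrame.coeff_mlieBracket [FiniteDimensional ℝ E] (h : IsDualFrame e θ)
    {c : ι → ι → ι → ℝ}
    (hc : ∀ α β x, VectorField.mlieBracket I (e α) (e β) x = ∑ γ, c α β γ • e γ x)
    {X Y : (x : M) → TangentSpace I x} (hX : SmoothField X) (hY : SmoothField Y) (γ : ι) (x : M) :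
    θ γ x (VectorField.mlieBracket I X Y x)
      = mvfderiv I (fun y => θ γ y (Y y)) x (X x) - mvfderiv I (fun y => θ γ y (X y)) x (Y x)
        + ∑ α, ∑ β, c α β γ * θ α x (X x) * θ β x (Y x) := by
  have : CompleteSpace E := FiniteDimensional.complete ℝ E
  -- the Leibniz rule in the second argument only; the first argument is treated by antisymmetry
  have expansion : ∀ X Y : (x : M) → TangentSpace I x, SmoothField X → SmoothField Y →
      VectorField.mlieBracket I X Y x = ∑ β, (mvfderiv I (fun y => θ β y (Y y)) x (X x) • e β x
        + θ β x (Y x) • VectorField.mlieBracket I X (e β) x) := by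
    intro X Y hX hY
    have hYe : Y = fun y => ∑ β, ((fun y => θ β y (Y y)) • e β) y := by
      funext y; exact (h.expand y (Y y)).symm
    conv_lhs => rw [hYe]
    rw [mlieBracket_sum_right (fun β _ => (h.smooth β).smul (h.contMDiff_coeff hY β))]
    refine Finset.sum_congr rfl fun β _ => ?_
    exact mlieBracket_smul_right ((h.contMDiff_coeff hY β).mdiffAt x) ((h.smooth β).mdiff x)
  have hXe : ∀ β, θ γ x (VectorField.mlieBracket I X (e β) x)
      = - mvfderiv I (fun y => θ γ y (X y)) x (e β x) + ∑ α, c α β γ * θ α x (X x) := by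
    intro β
    rw [mlieBracket_swap_apply, expansion _ _ (h.smooth β) hX, map_neg, map_sum,
      Finset.sum_congr rfl fun α _ => by
        rw [map_add, map_smul, map_smul, mlieBracket_swap_apply, hc, map_neg, h.coeff_sum, h.dual]]
    simp only [smul_eq_mul, mul_ite, mul_one, mul_zero, mul_neg, Finset.sum_add_distrib,
      Finset.sum_neg_distrib, Finset.sum_ite_eq, Finset.mem_univ, if_true, neg_add, neg_neg]
    congr 1
    exact Finset.sum_congr rfl fun α _ => mul_comm _ _
  have hdX : mvfderiv I (fun y => θ γ y (X y)) x (Y x)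
      = ∑ β, θ β x (Y x) * mvfderiv I (fun y => θ γ y (X y)) x (e β x) := by
    conv_lhs => rw [← h.expand x (Y x)]
    simp [map_sum]
  rw [expansion X Y hX hY, map_sum, Finset.sum_congr rfl fun β _ => by
    rw [map_add, map_smul, map_smul, hXe, h.dual], hdX, Finset.sum_comm]
  simp only [smul_eq_mul, mul_ite, mul_one, mul_zero, mul_add, mul_neg, Finset.sum_add_distrib,
    Finset.sum_neg_distrib, Finset.sum_ite_eq, Finset.mem_univ, if_true, Finset.mul_sum]
  rw [← add_assoc, ← sub_eq_add_neg]
  congr 1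
  exact Finset.sum_congr rfl fun β _ => Finset.sum_congr rfl fun α _ => by ring

/-- The connection forms `ω_β^γ(v) = ∑ α, Γ_{αβ}^γ θ^α(v)` of symbols `Γ α β γ = Γ_{αβ}^γ`. -/
def connForm (θ : ι → (x : M) → TangentSpace I x →L[ℝ] ℝ) (Γ : ι → ι → ι → M → ℝ) (β γ : ι)
    (x : M) : TangentSpace I x →L[ℝ] ℝ :=
  ∑ α, Γ α β γ x • θ α x

/-- The connection whose symbols in the frame `e` are `Γ α β γ = Γ_{αβ}^γ`. -/
def frameConn (e : ι → (x : M) → TangentSpace I x) (θ : ι → (x : M) → TangentSpace I x →L[ℝ] ℝ)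
    (Γ : ι → ι → ι → M → ℝ) (Y : (x : M) → TangentSpace I x) (x : M) :
    TangentSpace I x →L[ℝ] TangentSpace I x :=
  ∑ γ, (mvfderiv I (fun y => θ γ y (Y y)) x
    + ∑ β, θ β x (Y x) • connForm θ Γ β γ x).smulRight (e γ x)

/-- The coefficients of `∇_v Y` are `d(Y^γ)(v) + ∑ β, ω_β^γ(v) Y^β`. -/
theorem IsDualFrame.coeff_frameConn (h : IsDualFrame e θ) (Γ : ι → ι → ι → M → ℝ)
    (Y : (x : M) → TangentSpace I x) (x : M) (v : TangentSpace I x) (γ : ι) :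
    θ γ x (frameConn e θ Γ Y x v) = mvfderiv I (fun y => θ γ y (Y y)) x v
      + ∑ β, connForm θ Γ β γ x v * θ β x (Y x) := by
  simp only [frameConn, FunLike.coe_sum, Finset.sum_apply,
    ContinuousLinearMap.smulRight_apply]
  rw [h.coeff_sum]
  simp [mul_comm]

theorem IsDualFrame.connForm_frame (h : IsDualFrame e θ) (Γ : ι → ι → ι → M → ℝ) (α β γ : ι)
    (x : M) : connForm θ Γ β γ x (e α x) = Γ α β γ x := by
  simp [connForm, h.dual]

theorem IsDualFrame.coeff_frameConn_frame (h : IsDualFrame e θ) (Γ : ι → ι → ι → M → ℝ)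
    (α β γ : ι) (x : M) : θ γ x (frameConn e θ Γ (e β) x (e α x)) = Γ α β γ x := by
  rw [h.coeff_frameConn]
  have : (fun y => θ γ y (e β y)) = fun _ => if γ = β then 1 else 0 := by
    funext y; exact h.dual γ β y
  rw [this, mvfderiv_const]
  simp [h.dual, h.connForm_frame]

theorem IsDualFrame.isCovariantDerivativeOn_frameConn [FiniteDimensional ℝ E]
    (h : IsDualFrame e θ) (Γ : ι → ι → ι → M → ℝ) :
    IsCovariantDerivativeOn E (frameConn e θ Γ) Set.univ where
  add {σ σ' x} hσ hσ' _ := by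
    ext1 v
    refine h.ext fun γ => ?_
    have h1 : (fun y => θ γ y ((σ + σ') y)) = fun y => θ γ y (σ y) + θ γ y (σ' y) := by
      funext y; simp
    rw [add_apply, map_add, h.coeff_frameConn, h.coeff_frameConn,
      h.coeff_frameConn, h1, mvfderiv_fun_add (h.mdifferentiableAt_coeff hσ γ)
        (h.mdifferentiableAt_coeff hσ' γ)]
    simp only [Pi.add_apply, map_add, add_apply, mul_add,
      Finset.sum_add_distrib]
    ring
  leibniz {σ g x} hσ hg _ := by
    ext1 v
    refine h.ext fun γ => ?_
    have h1 : (fun y => θ γ y ((g • σ) y)) = fun y => g y * θ γ y (σ y) := by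
      funext y; simp
    rw [add_apply, map_add, smul_apply, map_smul,
      h.coeff_frameConn, h.coeff_frameConn, h1,
      mvfderiv_fun_mul hg (h.mdifferentiableAt_coeff hσ γ)]
    simp only [Pi.smul_apply', map_smul, add_apply,
      smul_apply, smul_eq_mul, ContinuousLinearMap.smulRight_apply, mul_add,
      Finset.mul_sum]
    have : ∀ β, connForm θ Γ β γ x v * (g x * θ β x (σ x))
        = g x * (connForm θ Γ β γ x v * θ β x (σ x)) := fun β => by ring
    simp only [this]
    ring

theorem IsDualFrame.contMDiff_connForm [FiniteDimensional ℝ E] (h : IsDualFrame e θ)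
    {Γ : ι → ι → ι → M → ℝ} (hΓ : ∀ α β γ, ContMDiff I 𝓘(ℝ, ℝ) ∞ (Γ α β γ))
    {X : (x : M) → TangentSpace I x} (hX : SmoothField X) (β γ : ι) :
    ContMDiff I 𝓘(ℝ, ℝ) ∞ (fun x => connForm θ Γ β γ x (X x)) := by
  simp only [connForm, FunLike.coe_sum, Finset.sum_apply,
    smul_apply, smul_eq_mul]
  exact contMDiff_finsetSum fun α _ => (hΓ α β γ).mul (h.contMDiff_coeff hX α)

theorem IsDualFrame.smoothField_frameConn [FiniteDimensional ℝ E] (h : IsDualFrame e θ)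
    {Γ : ι → ι → ι → M → ℝ} (hΓ : ∀ α β γ, ContMDiff I 𝓘(ℝ, ℝ) ∞ (Γ α β γ))
    {X Y : (x : M) → TangentSpace I x} (hX : SmoothField X) (hY : SmoothField Y) :
    SmoothField (fun x => frameConn e θ Γ Y x (X x)) := by
  refine h.smoothField_of_coeff fun γ => ?_
  simp only [h.coeff_frameConn]
  exact (hX.contMDiff_mvfderiv (h.contMDiff_coeff hY γ)).add
    (contMDiff_finsetSum fun β _ => (h.contMDiff_connForm hΓ hX β γ).mul (h.contMDiff_coeff hY β))

end GlobalFrame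

/-! ### The Levi-Civita connection in a frame -/

section GlobalFrame

variable {E : Type*} [NormedAddCommGroup E] [NormedSpace ℝ E]
  {H : Type*} [TopologicalSpace H] {I : ModelWithCorners ℝ E H}
  {M : Type*} [TopologicalSpace M] [ChartedSpace H M]
variable [IsManifold I ∞ M] {ι : Type*} [Fintype ι] [DecidableEq ι]
variable {e : ι → (x : M) → TangentSpace I x} {θ : ι → (x : M) → TangentSpace I x →L[ℝ] ℝ}

/-- The symbols `Γ_{αβ}^γ` of the Levi-Civita connection of `∑ α, G α • θ^α ⊗ θ^α`, as given by the
Koszul formula in a frame with structure constants `[e α, e β] = ∑ γ, c α β γ • e γ`. -/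
def koszul (e : ι → (x : M) → TangentSpace I x) (G : ι → M → ℝ) (c : ι → ι → ι → ℝ)
    (α β γ : ι) (x : M) : ℝ :=
  1 / 2 * (G γ x)⁻¹ * ((if β = γ then mvfderiv I (G β) x (e α x) else 0)
    + (if α = γ then mvfderiv I (G α) x (e β x) else 0)
    - (if α = β then mvfderiv I (G α) x (e γ x) else 0)
    + c α β γ * G γ x - c α γ β * G β x - c β γ α * G α x)

theorem IsDualFrame.frameMetric_frame_right (h : IsDualFrame e θ) (G : ι → M → ℝ) (x : M)
    (v : TangentSpace I x) (β : ι) : frameMetric θ G x v (e β x) = G β x * θ β x v := by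
  simp [frameMetric_apply, h.dual]

theorem IsDualFrame.frameMetric_frame_left (h : IsDualFrame e θ) (G : ι → M → ℝ) (x : M)
    (v : TangentSpace I x) (β : ι) : frameMetric θ G x (e β x) v = G β x * θ β x v := by
  simp [frameMetric_apply, h.dual]

theorem IsDualFrame.frameMetric_frame (h : IsDualFrame e θ) (G : ι → M → ℝ) (x : M) (α β : ι) :
    frameMetric θ G x (e α x) (e β x) = if α = β then G α x else 0 := by
  rw [h.frameMetric_frame_left, h.dual]
  simp

theorem IsDualFrame.structure_antisymm (h : IsDualFrame e θ) [Nonempty M] {c : ι → ι → ι → ℝ}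
    (hc : ∀ α β x, VectorField.mlieBracket I (e α) (e β) x = ∑ γ, c α β γ • e γ x) (α β γ : ι) :
    c α β γ = - c β α γ := by
  obtain ⟨x⟩ := ‹Nonempty M›
  have := congrArg (θ γ x) (mlieBracket_swap_apply (I := I) (V := e α) (W := e β) (x := x))
  rwa [map_neg, hc, hc, h.coeff_sum, h.coeff_sum] at this

theorem contMDiff_koszul [FiniteDimensional ℝ E] (h : IsDualFrame e θ) {G : ι → M → ℝ}
    (hG : ∀ α, ContMDiff I 𝓘(ℝ, ℝ) ∞ (G α)) (hG0 : ∀ α x, G α x ≠ 0) (c : ι → ι → ι → ℝ)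
    (α β γ : ι) : ContMDiff I 𝓘(ℝ, ℝ) ∞ (koszul e G c α β γ) := by
  have hd : ∀ α β : ι, ContMDiff I 𝓘(ℝ, ℝ) ∞ (fun x => mvfderiv I (G α) x (e β x)) :=
    fun α β => (h.smooth β).contMDiff_mvfderiv (hG α)
  have hif : ∀ (p : Prop) [Decidable p] (f : M → ℝ), ContMDiff I 𝓘(ℝ, ℝ) ∞ f →
      ContMDiff I 𝓘(ℝ, ℝ) ∞ (fun x => if p then f x else 0) := by
    intro p _ f hf
    by_cases hp : p
    · simpa [hp] using hf
    · simpa [hp] using contMDiff_const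
  have hm : ∀ (r : ℝ) (α : ι), ContMDiff I 𝓘(ℝ, ℝ) ∞ (fun x => r * G α x) :=
    fun r α => contMDiff_const.mul (hG α)
  exact (contMDiff_const.mul ((hG γ).inv₀ (hG0 γ))).mul
    ((((((hif _ _ (hd β α)).add (hif _ _ (hd α β))).sub (hif _ _ (hd α γ))).add (hm _ γ)).sub
      (hm _ β)).sub (hm _ α))

/-- The connection with the Koszul symbols is a Levi-Civita connection. -/
theorem IsDualFrame.isLeviCivita_frameConn [FiniteDimensional ℝ E] (h : IsDualFrame e θ)
    {c : ι → ι → ι → ℝ}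
    (hc : ∀ α β x, VectorField.mlieBracket I (e α) (e β) x = ∑ γ, c α β γ • e γ x)
    {G : ι → M → ℝ} (hG : ∀ α, ContMDiff I 𝓘(ℝ, ℝ) ∞ (G α)) (hG0 : ∀ α x, G α x ≠ 0) :
    IsLeviCivita (frameMetric θ G) (frameConn e θ (koszul e G c)) where
  isCovariantDerivative := h.isCovariantDerivativeOn_frameConn _
  torsion_free X Y hX hY x := by
    have : Nonempty M := ⟨x⟩
    refine h.ext fun γ => ?_
    rw [map_sub, h.coeff_frameConn, h.coeff_frameConn, h.coeff_mlieBracket hc hX hY]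
    -- torsion-freeness in the frame
    have hΓ : ∀ α β, koszul e G c α β γ x - koszul e G c β α γ x = c α β γ := by
      intro α β
      have h0 := hG0 γ x
      have hs := h.structure_antisymm hc β α γ
      have h1 : (if α = β then mvfderiv I (G α) x (e γ x) else 0)
          = (if β = α then mvfderiv I (G β) x (e γ x) else 0) := by
        by_cases hab : α = β
        · subst hab; rfl
        · simp [hab, Ne.symm hab]
      unfold koszul
      rw [h1, hs]
      field_simp
      ring
    have key : ∑ β, connForm θ (koszul e G c) β γ x (X x) * θ β x (Y x)
        - ∑ β, connForm θ (koszul e G c) β γ x (Y x) * θ β x (X x)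
        = ∑ α, ∑ β, c α β γ * θ α x (X x) * θ β x (Y x) := by
      simp only [connForm, FunLike.coe_sum, Finset.sum_apply, smul_apply, smul_eq_mul,
        Finset.sum_mul]
      rw [Finset.sum_comm, ← Finset.sum_sub_distrib]
      refine Finset.sum_congr rfl fun α _ => ?_
      rw [← Finset.sum_sub_distrib]
      refine Finset.sum_congr rfl fun β _ => ?_
      rw [← hΓ α β]
      ring
    linear_combination key
  metric X Y Z hX hY hZ x := by
    have hy := fun α => h.contMDiff_coeff hY α
    have hz := fun α => h.contMDiff_coeff hZ α
    -- compatibility with the metric in the frame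
    have hΓ : ∀ α β γ, G γ x * koszul e G c α β γ x + G β x * koszul e G c α γ β x
        = if β = γ then mvfderiv I (G β) x (e α x) else 0 := by
      have : Nonempty M := ⟨x⟩
      intro α β γ
      have h0 := hG0 γ x
      have h0' := hG0 β x
      have h1 : (if γ = β then mvfderiv I (G γ) x (e α x) else 0)
          = (if β = γ then mvfderiv I (G β) x (e α x) else 0) := by
        by_cases hab : β = γ
        · subst hab; rfl
        · simp [hab, Ne.symm hab]
      unfold koszul
      rw [h1, h.structure_antisymm hc γ β α]
      field_simp
      ring
    have hω : ∀ β γ, G γ x * connForm θ (koszul e G c) β γ x (X x)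
        + G β x * connForm θ (koszul e G c) γ β x (X x)
        = if β = γ then mvfderiv I (G β) x (X x) else 0 := by
      intro β γ
      simp only [connForm, FunLike.coe_sum, Finset.sum_apply, smul_apply, smul_eq_mul,
        Finset.mul_sum]
      rw [← Finset.sum_add_distrib]
      have : ∀ α, G γ x * (koszul e G c α β γ x * θ α x (X x))
          + G β x * (koszul e G c α γ β x * θ α x (X x))
          = θ α x (X x) * (if β = γ then mvfderiv I (G β) x (e α x) else 0) := by
        intro α; rw [← hΓ]; ring
      simp only [this]
      split_ifs with hbg
      · conv_rhs => rw [← h.expand x (X x)]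
        simp [map_sum]
      · simp
    simp only [frameMetric_apply]
    rw [mvfderiv_fun_sum (f := fun α y => G α y * θ α y (Y y) * θ α y (Z y))
      (fun α _ => (((hG α).mul (hy α)).mul (hz α)).mdiffAt x)]
    have h1 : ∀ α, mvfderiv I (fun y => G α y * θ α y (Y y) * θ α y (Z y)) x (X x)
        = mvfderiv I (G α) x (X x) * θ α x (Y x) * θ α x (Z x)
          + G α x * mvfderiv I (fun y => θ α y (Y y)) x (X x) * θ α x (Z x)
          + G α x * θ α x (Y x) * mvfderiv I (fun y => θ α y (Z y)) x (X x) := by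
      intro α
      rw [mvfderiv_fun_mul (f := fun y => G α y * θ α y (Y y)) (((hG α).mul (hy α)).mdiffAt x)
          ((hz α).mdiffAt x),
        mvfderiv_fun_mul ((hG α).mdiffAt x) ((hy α).mdiffAt x)]
      simp only [add_apply, smul_apply, smul_eq_mul]
      ring
    simp only [FunLike.coe_sum, Finset.sum_apply, h1, h.coeff_frameConn]
    have key : ∑ γ, mvfderiv I (G γ) x (X x) * θ γ x (Y x) * θ γ x (Z x)
        = ∑ γ, G γ x * (∑ β, connForm θ (koszul e G c) β γ x (X x) * θ β x (Y x)) * θ γ x (Z x)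
          + ∑ γ, G γ x * θ γ x (Y x)
            * ∑ β, connForm θ (koszul e G c) β γ x (X x) * θ β x (Z x) := by
      simp only [Finset.mul_sum, Finset.sum_mul]
      rw [add_comm, Finset.sum_comm, ← Finset.sum_add_distrib]
      refine Finset.sum_congr rfl fun γ _ => ?_
      rw [← Finset.sum_add_distrib]
      have : ∀ β, G β x * θ β x (Y x) * (connForm θ (koszul e G c) γ β x (X x) * θ γ x (Z x))
          + G γ x * (connForm θ (koszul e G c) β γ x (X x) * θ β x (Y x)) * θ γ x (Z x)
          = (if β = γ then mvfderiv I (G β) x (X x) else 0) * θ β x (Y x) * θ γ x (Z x) := by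
        intro β; rw [← hω]; ring
      simp [this]
    simp only [mul_add, add_mul, Finset.sum_add_distrib]
    rw [key]
    ring

/-- The symbols of any Levi-Civita connection are given by the Koszul formula. -/
theorem IsDualFrame.symbols_eq_koszul (h : IsDualFrame e θ) {c : ι → ι → ι → ℝ}
    (hc : ∀ α β x, VectorField.mlieBracket I (e α) (e β) x = ∑ γ, c α β γ • e γ x)
    {G : ι → M → ℝ} (hG0 : ∀ α x, G α x ≠ 0)
    {cov : ((x : M) → TangentSpace I x) → (x : M) → TangentSpace I x →L[ℝ] TangentSpace I x}
    (hcov : IsLeviCivita (frameMetric θ G) cov) (x : M) (α β γ : ι) :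
    θ γ x (cov (e β) x (e α x)) = koszul e G c α β γ x := by
  have ht : ∀ α β γ, θ γ x (cov (e β) x (e α x)) - θ γ x (cov (e α) x (e β x)) = c α β γ := by
    intro α β γ
    rw [← map_sub, hcov.torsion_free _ _ (h.smooth α) (h.smooth β), hc, h.coeff_sum]
  -- solve the cyclic permutations of the metric condition for the symbol
  have hm : ∀ α β γ, (if β = γ then mvfderiv I (G β) x (e α x) else 0)
      = G γ x * θ γ x (cov (e β) x (e α x)) + G β x * θ β x (cov (e γ) x (e α x)) := by
    intro α β γ
    have := hcov.metric _ _ _ (h.smooth α) (h.smooth β) (h.smooth γ) x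
    rw [h.frameMetric_frame_left, h.frameMetric_frame_right] at this
    rw [← this]
    have h1 : (fun y => frameMetric θ G y (e β y) (e γ y))
        = fun y => if β = γ then G β y else 0 := by
      funext y; exact h.frameMetric_frame G y β γ
    rw [h1]
    split_ifs
    · rfl
    · rw [mvfderiv_const]; rfl
  have h0 := hG0 γ x
  unfold koszul
  rw [hm α β γ, hm β α γ, hm γ α β, ← ht α β γ, ← ht α γ β, ← ht β γ α]
  field_simp
  ring

theorem IsCovariantDerivativeOn.sum_frame [FiniteDimensional ℝ E]
    {cov : ((x : M) → TangentSpace I x) → (x : M) → TangentSpace I x →L[ℝ] TangentSpace I x}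
    (hcov : IsCovariantDerivativeOn E cov Set.univ) {κ : Type*} {s : Finset κ}
    {Y : κ → (x : M) → TangentSpace I x} (hY : ∀ k ∈ s, SmoothField (Y k)) (x : M) :
    cov (fun y => ∑ k ∈ s, Y k y) x = ∑ k ∈ s, cov (Y k) x := by
  classical
  induction s using Finset.induction_on with
  | empty =>
    simp only [Finset.sum_empty]
    exact hcov.zero
  | insert a s ha ih =>
    have h1 : (fun y => ∑ k ∈ insert a s, Y k y) = Y a + fun y => ∑ k ∈ s, Y k y := by
      funext y; simp [Finset.sum_insert ha]
    have h2 : ∀ k ∈ s, SmoothField (Y k) := fun k hk => hY k (by simp [hk])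
    rw [h1, hcov.add ((hY a (by simp)).mdiff x) ((SmoothField.sum h2).mdiff x),
      Finset.sum_insert ha, ih h2]

/-- Two covariant derivatives which agree on the fields of a frame agree on smooth fields. -/
theorem IsDualFrame.cov_eq_of_frame [FiniteDimensional ℝ E] (h : IsDualFrame e θ)
    {cov cov' : ((x : M) → TangentSpace I x) → (x : M) → TangentSpace I x →L[ℝ] TangentSpace I x}
    (hcov : IsCovariantDerivativeOn E cov Set.univ)
    (hcov' : IsCovariantDerivativeOn E cov' Set.univ)
    (he : ∀ α β γ x, θ γ x (cov (e β) x (e α x)) = θ γ x (cov' (e β) x (e α x)))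
    {Y : (x : M) → TangentSpace I x} (hY : SmoothField Y) : cov Y = cov' Y := by
  have hb : ∀ β x, cov (e β) x = cov' (e β) x := by
    intro β x
    ext1 v
    rw [← h.expand x v, map_sum, map_sum]
    refine Finset.sum_congr rfl fun α _ => ?_
    rw [map_smul, map_smul, h.ext fun γ => he α β γ x]
  have hYe : Y = fun y => ∑ β, ((fun y => θ β y (Y y)) • e β) y := by
    funext y; exact (h.expand y (Y y)).symm
  have hs : ∀ β ∈ Finset.univ, SmoothField ((fun y => θ β y (Y y)) • e β) :=
    fun β _ => (h.smooth β).smul (h.contMDiff_coeff hY β)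
  funext x
  rw [hYe, hcov.sum_frame hs, hcov'.sum_frame hs]
  refine Finset.sum_congr rfl fun β _ => ?_
  rw [hcov.leibniz ((h.smooth β).mdiff x) ((h.contMDiff_coeff hY β).mdiffAt x),
    hcov'.leibniz ((h.smooth β).mdiff x) ((h.contMDiff_coeff hY β).mdiffAt x), hb]

section LeviCivita

variable [FiniteDimensional ℝ E] {c : ι → ι → ι → ℝ} {G : ι → M → ℝ}

theorem IsDualFrame.isLeviCivita_leviCivita (h : IsDualFrame e θ)
    (hc : ∀ α β x, VectorField.mlieBracket I (e α) (e β) x = ∑ γ, c α β γ • e γ x)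
    (hG : ∀ α, ContMDiff I 𝓘(ℝ, ℝ) ∞ (G α)) (hG0 : ∀ α x, G α x ≠ 0) :
    IsLeviCivita (frameMetric θ G) (leviCivita (frameMetric θ G)) :=
  Classical.epsilon_spec ⟨_, h.isLeviCivita_frameConn hc hG hG0⟩

theorem IsDualFrame.frameSymbol_eq_koszul (h : IsDualFrame e θ)
    (hc : ∀ α β x, VectorField.mlieBracket I (e α) (e β) x = ∑ γ, c α β γ • e γ x)
    (hG : ∀ α, ContMDiff I 𝓘(ℝ, ℝ) ∞ (G α)) (hG0 : ∀ α x, G α x ≠ 0) (x : M) (α β γ : ι) :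
    frameSymbol (frameMetric θ G) e θ x α β γ = koszul e G c α β γ x :=
  h.symbols_eq_koszul hc hG0 (h.isLeviCivita_leviCivita hc hG hG0) x α β γ

/-- On smooth fields the Levi-Civita connection, which is only specified through the predicate
`IsLeviCivita`, is the explicit connection with the Koszul symbols. -/
theorem IsDualFrame.leviCivita_eq_frameConn (h : IsDualFrame e θ)
    (hc : ∀ α β x, VectorField.mlieBracket I (e α) (e β) x = ∑ γ, c α β γ • e γ x)
    (hG : ∀ α, ContMDiff I 𝓘(ℝ, ℝ) ∞ (G α)) (hG0 : ∀ α x, G α x ≠ 0)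
    {Y : (x : M) → TangentSpace I x} (hY : SmoothField Y) :
    leviCivita (frameMetric θ G) Y = frameConn e θ (koszul e G c) Y :=
  h.cov_eq_of_frame (h.isLeviCivita_leviCivita hc hG hG0).isCovariantDerivative
    (h.isCovariantDerivativeOn_frameConn _)
    (fun α β γ x => by
      rw [h.coeff_frameConn_frame]; exact h.frameSymbol_eq_koszul hc hG hG0 x α β γ) hY

end LeviCivita

end GlobalFrame

/-! ### Curvature in a frame -/

section GlobalFrame

variable {E : Type*} [NormedAddCommGroup E] [NormedSpace ℝ E]
  {H : Type*} [TopologicalSpace H] {I : ModelWithCorners ℝ E H}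
  {M : Type*} [TopologicalSpace M] [ChartedSpace H M]
variable [IsManifold I ∞ M] {ι : Type*} [Fintype ι] [DecidableEq ι]
variable {e : ι → (x : M) → TangentSpace I x} {θ : ι → (x : M) → TangentSpace I x →L[ℝ] ℝ}

/-- The components `R_{αβγ}^δ` of the curvature of the connection with symbols `Γ`, in a frame with
structure constants `c`. -/
def curvComp (e : ι → (x : M) → TangentSpace I x) (Γ : ι → ι → ι → M → ℝ) (c : ι → ι → ι → ℝ)
    (α β γ δ : ι) (x : M) : ℝ :=
  mvfderiv I (Γ β γ δ) x (e α x) - mvfderiv I (Γ α γ δ) x (e β x)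
    - ∑ μ, c α β μ * Γ μ γ δ x + ∑ ν, (Γ α ν δ x * Γ β γ ν x - Γ β ν δ x * Γ α γ ν x)

section

variable [FiniteDimensional ℝ E] {c : ι → ι → ι → ℝ} {Γ : ι → ι → ι → M → ℝ}

/-- The curvature two-form `dω_γ^δ + ∑ ν, ω_ν^δ ∧ ω_γ^ν` evaluated on the coefficients of `X`
and `Y`. -/
theorem IsDualFrame.curvature_form (h : IsDualFrame e θ)
    (hc : ∀ α β x, VectorField.mlieBracket I (e α) (e β) x = ∑ γ, c α β γ • e γ x)
    (hΓ : ∀ α β γ, ContMDiff I 𝓘(ℝ, ℝ) ∞ (Γ α β γ))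
    {X Y : (x : M) → TangentSpace I x} (hX : SmoothField X) (hY : SmoothField Y) (x : M)
    (γ δ : ι) :
    mvfderiv I (fun y => connForm θ Γ γ δ y (Y y)) x (X x)
      - mvfderiv I (fun y => connForm θ Γ γ δ y (X y)) x (Y x)
      - connForm θ Γ γ δ x (VectorField.mlieBracket I X Y x)
      + ∑ ν, (connForm θ Γ ν δ x (X x) * connForm θ Γ γ ν x (Y x)
        - connForm θ Γ ν δ x (Y x) * connForm θ Γ γ ν x (X x))
      = ∑ α, ∑ β, curvComp e Γ c α β γ δ x * θ α x (X x) * θ β x (Y x) := by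
  have hd : ∀ X Y : (x : M) → TangentSpace I x, SmoothField Y →
      mvfderiv I (fun y => connForm θ Γ γ δ y (Y y)) x (X x)
        = ∑ α, ∑ β, mvfderiv I (Γ β γ δ) x (e α x) * θ α x (X x) * θ β x (Y x)
          + ∑ β, Γ β γ δ x * mvfderiv I (fun y => θ β y (Y y)) x (X x) := by
    intro X Y hY
    simp only [connForm, FunLike.coe_sum, Finset.sum_apply, smul_apply, smul_eq_mul]
    rw [mvfderiv_fun_sum (f := fun β y => Γ β γ δ y * θ β y (Y y))
      (fun β _ => ((hΓ β γ δ).mul (h.contMDiff_coeff hY β)).mdiffAt x)]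
    simp only [FunLike.coe_sum, Finset.sum_apply]
    rw [Finset.sum_comm, ← Finset.sum_add_distrib]
    refine Finset.sum_congr rfl fun β _ => ?_
    rw [mvfderiv_fun_mul ((hΓ β γ δ).mdiffAt x) ((h.contMDiff_coeff hY β).mdiffAt x)]
    simp only [add_apply, smul_apply, smul_eq_mul]
    have : mvfderiv I (Γ β γ δ) x (X x)
        = ∑ α, θ α x (X x) * mvfderiv I (Γ β γ δ) x (e α x) := by
      conv_lhs => rw [← h.expand x (X x)]
      simp [map_sum]
    rw [this, Finset.mul_sum, add_comm]
    congr 1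
    exact Finset.sum_congr rfl fun α _ => by ring
  -- the term with the Lie bracket
  have hb : connForm θ Γ γ δ x (VectorField.mlieBracket I X Y x)
      = ∑ β, Γ β γ δ x * mvfderiv I (fun y => θ β y (Y y)) x (X x)
        - ∑ β, Γ β γ δ x * mvfderiv I (fun y => θ β y (X y)) x (Y x)
        + ∑ α, ∑ β, (∑ μ, c α β μ * Γ μ γ δ x) * θ α x (X x) * θ β x (Y x) := by
    simp only [connForm, FunLike.coe_sum, Finset.sum_apply, smul_apply, smul_eq_mul,
      h.coeff_mlieBracket hc hX hY, mul_add, mul_sub, Finset.sum_add_distrib,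
      Finset.sum_sub_distrib]
    congr 1
    simp only [Finset.mul_sum, Finset.sum_mul]
    rw [Finset.sum_comm]
    refine Finset.sum_congr rfl fun α _ => ?_
    rw [Finset.sum_comm]
    exact Finset.sum_congr rfl fun β _ => Finset.sum_congr rfl fun μ _ => by ring
  -- the quadratic terms
  have hq : ∀ X Y : (x : M) → TangentSpace I x,
      ∑ ν, connForm θ Γ ν δ x (X x) * connForm θ Γ γ ν x (Y x)
        = ∑ α, ∑ β, (∑ ν, Γ α ν δ x * Γ β γ ν x) * θ α x (X x) * θ β x (Y x) := by
    intro X Y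
    simp only [connForm, FunLike.coe_sum, Finset.sum_apply, smul_apply, smul_eq_mul,
      Finset.mul_sum, Finset.sum_mul]
    rw [Finset.sum_congr rfl fun ν _ => Finset.sum_comm, Finset.sum_comm]
    refine Finset.sum_congr rfl fun α _ => ?_
    rw [Finset.sum_comm]
    exact Finset.sum_congr rfl fun β _ => Finset.sum_congr rfl fun μ _ => by ring
  have hswap : ∀ f : ι → ι → ℝ, ∑ α, ∑ β, f α β * θ α x (Y x) * θ β x (X x)
      = ∑ α, ∑ β, f β α * θ α x (X x) * θ β x (Y x) := by
    intro f
    rw [Finset.sum_comm]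
    exact Finset.sum_congr rfl fun β _ => Finset.sum_congr rfl fun μ _ => by ring
  rw [Finset.sum_sub_distrib, hd X Y hY, hd Y X hX, hb, hq X Y, hq Y X, hswap, hswap]
  simp only [curvComp, add_mul, sub_mul, Finset.sum_add_distrib, Finset.sum_sub_distrib]
  ring

/-- The expression defining the curvature tensor depends only on the values of the three fields at
the point: the terms with derivatives of their coefficients cancel, the second derivatives of the
coefficients of `Z` by `SmoothField.mvfderiv_mlieBracket`. -/
theorem IsDualFrame.coeff_curvature (h : IsDualFrame e θ)
    (hc : ∀ α β x, VectorField.mlieBracket I (e α) (e β) x = ∑ γ, c α β γ • e γ x)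
    (hΓ : ∀ α β γ, ContMDiff I 𝓘(ℝ, ℝ) ∞ (Γ α β γ))
    {X Y Z : (x : M) → TangentSpace I x} (hX : SmoothField X) (hY : SmoothField Y)
    (hZ : SmoothField Z) (x : M) (δ : ι) :
    θ δ x (frameConn e θ Γ (fun y => frameConn e θ Γ Z y (Y y)) x (X x)
      - frameConn e θ Γ (fun y => frameConn e θ Γ Z y (X y)) x (Y x)
      - frameConn e θ Γ Z x (VectorField.mlieBracket I X Y x))
      = ∑ α, ∑ β, ∑ γ, curvComp e Γ c α β γ δ x * θ α x (X x) * θ β x (Y x) * θ γ x (Z x) := by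
  have : CompleteSpace E := FiniteDimensional.complete ℝ E
  have hd : ∀ X Y : (x : M) → TangentSpace I x, SmoothField Y →
      θ δ x (frameConn e θ Γ (fun y => frameConn e θ Γ Z y (Y y)) x (X x))
        = mvfderiv I (fun y => mvfderiv I (fun y => θ δ y (Z y)) y (Y y)) x (X x)
          + ∑ γ, mvfderiv I (fun y => connForm θ Γ γ δ y (Y y)) x (X x) * θ γ x (Z x)
          + ∑ γ, connForm θ Γ γ δ x (Y x) * mvfderiv I (fun y => θ γ y (Z y)) x (X x)
          + ∑ γ, connForm θ Γ γ δ x (X x) * mvfderiv I (fun y => θ γ y (Z y)) x (Y x)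
          + ∑ γ, (∑ ν, connForm θ Γ ν δ x (X x) * connForm θ Γ γ ν x (Y x)) * θ γ x (Z x) := by
    intro X Y hY
    have h1 : ∀ γ ∈ Finset.univ, MDiffAt
        (fun y => connForm θ Γ γ δ y (Y y) * θ γ y (Z y)) x := fun γ _ =>
      ((h.contMDiff_connForm hΓ hY γ δ).mul (h.contMDiff_coeff hZ γ)).mdiffAt x
    rw [h.coeff_frameConn]
    simp only [h.coeff_frameConn]
    rw [mvfderiv_fun_add ((hY.contMDiff_mvfderiv (h.contMDiff_coeff hZ δ)).mdiffAt x)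
      (mdifferentiableAt_fun_sum h1), mvfderiv_fun_sum h1]
    have h2 : ∀ γ, mvfderiv I (fun y => connForm θ Γ γ δ y (Y y) * θ γ y (Z y)) x (X x)
        = mvfderiv I (fun y => connForm θ Γ γ δ y (Y y)) x (X x) * θ γ x (Z x)
          + connForm θ Γ γ δ x (Y x) * mvfderiv I (fun y => θ γ y (Z y)) x (X x) := by
      intro γ
      rw [mvfderiv_fun_mul ((h.contMDiff_connForm hΓ hY γ δ).mdiffAt x)
        ((h.contMDiff_coeff hZ γ).mdiffAt x)]
      simp only [add_apply, smul_apply, smul_eq_mul]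
      ring
    simp only [add_apply, FunLike.coe_sum, Finset.sum_apply, h2, mul_add, Finset.sum_add_distrib,
      Finset.mul_sum, Finset.sum_mul]
    rw [Finset.sum_comm (f := fun γ ν => connForm θ Γ γ δ x (X x) * _)]
    simp only [mul_assoc]
    ring
  rw [map_sub, map_sub, hd X Y hY, hd Y X hX, h.coeff_frameConn,
    hX.mvfderiv_mlieBracket hY (h.smooth δ) (h.frame_ne_zero δ x) (h.contMDiff_coeff hZ δ)]
  have hr : ∑ α, ∑ β, ∑ γ, curvComp e Γ c α β γ δ x * θ α x (X x) * θ β x (Y x) * θ γ x (Z x)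
      = ∑ γ, (∑ α, ∑ β, curvComp e Γ c α β γ δ x * θ α x (X x) * θ β x (Y x)) * θ γ x (Z x) := by
    simp only [Finset.sum_mul]
    rw [Finset.sum_congr rfl fun α _ => Finset.sum_comm, Finset.sum_comm]
  rw [hr]
  simp only [← h.curvature_form hc hΓ hX hY, add_mul, sub_mul, Finset.sum_add_distrib,
    Finset.sum_sub_distrib]
  ring

theorem IsDualFrame.exists_isCurvatureTensor (h : IsDualFrame e θ)
    (hc : ∀ α β x, VectorField.mlieBracket I (e α) (e β) x = ∑ γ, c α β γ • e γ x)
    (hΓ : ∀ α β γ, ContMDiff I 𝓘(ℝ, ℝ) ∞ (Γ α β γ)) :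
    ∃ R, IsCurvatureTensor (frameConn e θ Γ) R := by
  refine ⟨fun x => ∑ α, ∑ β, ∑ γ, ∑ δ, curvComp e Γ c α β γ δ x •
    (θ α x).toLinearMap.smulRight ((θ β x).toLinearMap.smulRight
      ((θ γ x).toLinearMap.smulRight (e δ x))), ?_⟩
  intro X Y Z hX hY hZ x
  refine h.ext fun δ => ?_
  rw [h.coeff_curvature hc hΓ hX hY hZ]
  simp [LinearMap.sum_apply, map_sum, h.dual, mul_assoc]

end

/-- The Ricci tensor as the sum of the diagonal entries in the frame of the defining
endomorphism. -/
theorem IsDualFrame.ricci_eq_sum (h : IsDualFrame e θ) (G : ι → M → ℝ) (x : M)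
    (v w : TangentSpace I x) :
    ricci (frameMetric θ G) x v w = ∑ α, θ α x (curvature (frameMetric θ G) x (e α x) v w) := by
  let b : Module.Basis ι ℝ (TangentSpace I x) := Module.Basis.ofEquivFun
    { toFun := fun v i => θ i x v
      invFun := fun c => ∑ i, c i • e i x
      map_add' := fun v w => by ext; simp
      map_smul' := fun r v => by ext; simp
      left_inv := fun v => h.expand x v
      right_inv := fun c => by ext i; exact h.coeff_sum x c i }
  have hb : ∀ i, b i = e i x := fun i => by
    simp [b, Module.Basis.ofEquivFun, Pi.single_apply]
  rw [ricci, LinearMap.trace_eq_matrix_trace ℝ b, Matrix.trace]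
  refine Finset.sum_congr rfl fun α _ => ?_
  rw [Matrix.diag_apply, LinearMap.toMatrix_apply, hb]
  rfl

theorem IsDualFrame.ricci_eq_sum_frame (h : IsDualFrame e θ) (G : ι → M → ℝ) (x : M)
    (v w : TangentSpace I x) :
    ricci (frameMetric θ G) x v w
      = ∑ α, ∑ β, θ α x v * θ β x w * ricci (frameMetric θ G) x (e α x) (e β x) := by
  simp only [h.ricci_eq_sum, Finset.mul_sum]
  rw [Finset.sum_congr rfl fun α _ => Finset.sum_comm, Finset.sum_comm]
  refine Finset.sum_congr rfl fun μ _ => ?_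
  conv_lhs => rw [← h.expand x v, ← h.expand x w]
  simp only [map_sum, map_smul, LinearMap.sum_apply, LinearMap.smul_apply, smul_eq_mul,
    Finset.mul_sum]
  rw [Finset.sum_comm]
  exact Finset.sum_congr rfl fun α _ => Finset.sum_congr rfl fun β _ => by ring

section LeviCivita

variable [FiniteDimensional ℝ E] {c : ι → ι → ι → ℝ} {G : ι → M → ℝ}

/-- The curvature of the Levi-Civita connection only involves its values on smooth fields, hence is
that of the connection with the Koszul symbols. -/
theorem IsDualFrame.isCurvatureTensor_leviCivita_iff (h : IsDualFrame e θ)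
    (hc : ∀ α β x, VectorField.mlieBracket I (e α) (e β) x = ∑ γ, c α β γ • e γ x)
    (hG : ∀ α, ContMDiff I 𝓘(ℝ, ℝ) ∞ (G α)) (hG0 : ∀ α x, G α x ≠ 0)
    (R : (x : M) → TangentSpace I x →ₗ[ℝ] TangentSpace I x →ₗ[ℝ] TangentSpace I x →ₗ[ℝ]
      TangentSpace I x) :
    IsCurvatureTensor (leviCivita (frameMetric θ G)) R
      ↔ IsCurvatureTensor (frameConn e θ (koszul e G c)) R := by
  have hΓ := contMDiff_koszul h hG hG0 c
  refine forall_congr' fun X => forall_congr' fun Y => forall_congr' fun Z =>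
    forall_congr' fun hX => forall_congr' fun hY => forall_congr' fun hZ =>
    forall_congr' fun x => ?_
  rw [h.leviCivita_eq_frameConn hc hG hG0 hZ,
    h.leviCivita_eq_frameConn hc hG hG0 (h.smoothField_frameConn hΓ hX hZ),
    h.leviCivita_eq_frameConn hc hG hG0 (h.smoothField_frameConn hΓ hY hZ)]

theorem IsDualFrame.isCurvatureTensor_curvature (h : IsDualFrame e θ)
    (hc : ∀ α β x, VectorField.mlieBracket I (e α) (e β) x = ∑ γ, c α β γ • e γ x)
    (hG : ∀ α, ContMDiff I 𝓘(ℝ, ℝ) ∞ (G α)) (hG0 : ∀ α x, G α x ≠ 0) :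
    IsCurvatureTensor (leviCivita (frameMetric θ G)) (curvature (frameMetric θ G)) := by
  obtain ⟨R, hR⟩ := h.exists_isCurvatureTensor hc (contMDiff_koszul h hG hG0 c)
  exact Classical.epsilon_spec ⟨R, (h.isCurvatureTensor_leviCivita_iff hc hG hG0 R).2 hR⟩

theorem IsDualFrame.coeff_curvature_frame (h : IsDualFrame e θ)
    (hc : ∀ α β x, VectorField.mlieBracket I (e α) (e β) x = ∑ γ, c α β γ • e γ x)
    (hG : ∀ α, ContMDiff I 𝓘(ℝ, ℝ) ∞ (G α)) (hG0 : ∀ α x, G α x ≠ 0) (x : M) (α β γ δ : ι) :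
    θ δ x (curvature (frameMetric θ G) x (e α x) (e β x) (e γ x))
      = curvComp e (koszul e G c) c α β γ δ x := by
  have hR := (h.isCurvatureTensor_leviCivita_iff hc hG hG0 _).1
    (h.isCurvatureTensor_curvature hc hG hG0)
  rw [hR _ _ _ (h.smooth α) (h.smooth β) (h.smooth γ) x,
    h.coeff_curvature hc (contMDiff_koszul h hG hG0 c) (h.smooth α) (h.smooth β) (h.smooth γ)]
  simp [h.dual]

theorem IsDualFrame.Rm_frame (h : IsDualFrame e θ)
    (hc : ∀ α β x, VectorField.mlieBracket I (e α) (e β) x = ∑ γ, c α β γ • e γ x)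
    (hG : ∀ α, ContMDiff I 𝓘(ℝ, ℝ) ∞ (G α)) (hG0 : ∀ α x, G α x ≠ 0) (x : M) (α β γ δ : ι) :
    Rm (frameMetric θ G) x (e α x) (e β x) (e γ x) (e δ x)
      = G δ x * curvComp e (koszul e G c) c α β γ δ x := by
  rw [Rm, h.frameMetric_frame_right, h.coeff_curvature_frame hc hG hG0]

theorem IsDualFrame.ricci_frame (h : IsDualFrame e θ)
    (hc : ∀ α β x, VectorField.mlieBracket I (e α) (e β) x = ∑ γ, c α β γ • e γ x)
    (hG : ∀ α, ContMDiff I 𝓘(ℝ, ℝ) ∞ (G α)) (hG0 : ∀ α x, G α x ≠ 0) (x : M) (β γ : ι) :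
    ricci (frameMetric θ G) x (e β x) (e γ x)
      = ∑ α, curvComp e (koszul e G c) c α β γ α x := by
  rw [h.ricci_eq_sum]
  exact Finset.sum_congr rfl fun α _ => h.coeff_curvature_frame hc hG hG0 x α β γ α

end LeviCivita

end GlobalFrame

/-! ### Fields of initial velocities -/

section Velocity

variable {E : Type*} [NormedAddCommGroup E] [NormedSpace ℝ E]
  {H : Type*} [TopologicalSpace H] {I : ModelWithCorners ℝ E H}
  {M : Type*} [TopologicalSpace M] [ChartedSpace H M]
  {F : Type*} [NormedAddCommGroup F] [NormedSpace ℝ F]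
  {F' : Type*} [NormedAddCommGroup F'] [NormedSpace ℝ F']

theorem mvfderiv_clm_comp (ℓ : F →L[ℝ] F') {f : M → F} {x : M} (hf : MDiffAt f x)
    (v : TangentSpace I x) :
    mvfderiv I (fun y => ℓ (f y)) x v = ℓ (mvfderiv I f x v) := by
  have := mfderiv_comp_apply x (ℓ.differentiableAt (x := f x)).mdifferentiableAt hf v
  rw [mfderiv_eq_fderiv, ℓ.fderiv] at this
  exact this

/-- The field of initial velocities of the curves `t ↦ Φ (t, p)` issuing from `p`. The velocity is
transported along the equality `Φ (0, p) = p`, as it is in `circleField`. -/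
def velocityField (Φ : ℝ × M → M) (h0 : ∀ p, Φ (0, p) = p) (p : M) : TangentSpace I p :=
  (h0 p) ▸ (mfderiv 𝓘(ℝ, ℝ) I (fun t : ℝ => Φ (t, p)) 0 (1 : ℝ) : TangentSpace I (Φ (0, p)))

theorem hasDerivAt_velocityField {Φ : ℝ × M → M} (h0 : ∀ p, Φ (0, p) = p)
    (hΦ : ContMDiff (𝓘(ℝ, ℝ).prod I) I ∞ Φ) {f : M → F} {p : M} (hf : MDiffAt f p) :
    HasDerivAt (fun t : ℝ => f (Φ (t, p))) (mvfderiv I f p (velocityField Φ h0 p)) 0 := by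
  have h1 : ∀ (a b : M) (h : a = b) (v : TangentSpace I a),
      mvfderiv I f b (h ▸ v) = mvfderiv I f a v := by
    intro a b h v; subst h; rfl
  rw [velocityField, h1]
  have hf' : MDifferentiableAt I 𝓘(ℝ, F) f (Φ (0, p)) := by rw [h0]; exact hf
  have hc : MDifferentiableAt 𝓘(ℝ, ℝ) I (fun t : ℝ => Φ (t, p)) 0 :=
    ((hΦ (0, p)).mdifferentiableAt (by simp)).comp (0 : ℝ)
      (mdifferentiableAt_id.prodMk mdifferentiableAt_const)
  let A : ℝ →L[ℝ] F := (mvfderiv I f (Φ (0, p))).comp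
    (mfderiv 𝓘(ℝ, ℝ) I (fun t : ℝ => Φ (t, p)) 0)
  have h2 : HasFDerivAt (fun t : ℝ => f (Φ (t, p))) A 0 :=
    (hf'.hasMFDerivAt.comp (0 : ℝ) hc.hasMFDerivAt).hasFDerivAt
  exact h2.hasDerivAt

variable [IsManifold I ∞ M]

/-- The commutator formula for vector-valued functions, tested against continuous linear forms. -/
theorem SmoothField.mvfderiv_mlieBracket_vector [CompleteSpace E]
    {X Y Z : (x : M) → TangentSpace I x}
    (hX : SmoothField X) (hY : SmoothField Y) (hZ : SmoothField Z) {x : M} (hZx : Z x ≠ 0)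
    {f : M → F} (hf : ContMDiff I 𝓘(ℝ, F) ∞ f) :
    mvfderiv I f x (VectorField.mlieBracket I X Y x)
      = mvfderiv I (fun y => mvfderiv I f y (Y y)) x (X x)
        - mvfderiv I (fun y => mvfderiv I f y (X y)) x (Y x) := by
  refine (SeparatingDual.eq_iff_forall_dual_eq (R := ℝ)).2 fun ℓ => ?_
  have hd : ∀ {g : M → F}, ContMDiff I 𝓘(ℝ, F) ∞ g → ∀ y, MDiffAt g y :=
    fun hg y => (hg y).mdifferentiableAt (by simp)
  rw [map_sub, ← mvfderiv_clm_comp ℓ (hd hf x),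
    ← mvfderiv_clm_comp ℓ (hd (hY.contMDiff_mvfderiv hf) x),
    ← mvfderiv_clm_comp ℓ (hd (hX.contMDiff_mvfderiv hf) x),
    hX.mvfderiv_mlieBracket (f := fun y => ℓ (f y)) hY hZ hZx (ℓ.contDiff.contMDiff.comp hf)]
  simp only [mvfderiv_clm_comp ℓ (hd hf _)]

/-- The field of initial velocities is the tangent map of `Φ` applied to the smooth section
`p ↦ ((0, p), (1, 0))`. -/
theorem smoothField_velocityField {Φ : ℝ × M → M} (h0 : ∀ p, Φ (0, p) = p)
    (hΦ : ContMDiff (𝓘(ℝ, ℝ).prod I) I ∞ Φ) : SmoothField (velocityField (I := I) Φ h0) := by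
  have h1 : ∀ (a b : M) (h : a = b) (v : TangentSpace I a),
      (⟨b, h ▸ v⟩ : TangentBundle I M) = ⟨a, v⟩ := by
    intro a b h v; subst h; rfl
  have h2 : (fun p => (⟨p, velocityField (I := I) Φ h0 p⟩ : TangentBundle I M))
      = tangentMap (𝓘(ℝ, ℝ).prod I) I Φ ∘ (equivTangentBundleProd 𝓘(ℝ, ℝ) ℝ I M).symm
        ∘ fun p => ((⟨0, 1⟩ : TangentBundle 𝓘(ℝ, ℝ) ℝ), (⟨p, 0⟩ : TangentBundle I M)) := by
    funext p
    rw [velocityField, h1]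
    have h3 : mfderiv 𝓘(ℝ, ℝ) I (fun t : ℝ => Φ (t, p)) 0 (1 : ℝ)
        = mfderiv (𝓘(ℝ, ℝ).prod I) I Φ (0, p)
          (mfderiv 𝓘(ℝ, ℝ) (𝓘(ℝ, ℝ).prod I) (fun t : ℝ => (t, p)) 0 (1 : ℝ)) :=
      mfderiv_comp_apply (I' := 𝓘(ℝ, ℝ).prod I) (g := Φ) (f := fun t : ℝ => (t, p)) 0
        ((hΦ (0, p)).mdifferentiableAt (by simp))
        (mdifferentiableAt_id.prodMk mdifferentiableAt_const) (1 : ℝ)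
    rw [h3, mfderiv_prod_left]
    rfl
  unfold SmoothField
  rw [h2]
  refine (hΦ.contMDiff_tangentMap (m := ∞) (by simp)).comp
    (contMDiff_equivTangentBundleProd_symm.comp (ContMDiff.prodMk contMDiff_const ?_))
  exact contMDiff_zeroSection ℝ (TangentSpace I : M → Type _)

end Velocity

/-! ### The circle -/

section Circle

/-- The rotations `(t, p) ↦ p e^{it}` of the circle. -/
def circleFlow (x : ℝ × Circle) : Circle := x.2 * Circle.exp x.1

theorem circleFlow_zero (p : Circle) : circleFlow (0, p) = p := by simp [circleFlow]

theorem contMDiff_circleFlow : ContMDiff (𝓘(ℝ, ℝ).prod (𝓡 1)) (𝓡 1) ∞ circleFlow :=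
  contMDiff_snd.mul (contMDiff_circleExp.comp contMDiff_fst)

theorem smoothField_circleField : SmoothField circleField :=
  smoothField_velocityField circleFlow_zero contMDiff_circleFlow

theorem hasDerivAt_circleField {F : Type*} [NormedAddCommGroup F] [NormedSpace ℝ F]
    {f : Circle → F} {p : Circle} (hf : MDiffAt f p) :
    HasDerivAt (fun t : ℝ => f (p * Circle.exp t)) (mvfderiv (𝓡 1) f p (circleField p)) 0 :=
  hasDerivAt_velocityField circleFlow_zero contMDiff_circleFlow hf

theorem ddz_eq_mvfderiv {f : Circle → ℝ} {p : Circle} (hf : MDiffAt f p) :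
    ddz f p = mvfderiv (𝓡 1) f p (circleField p) :=
  (hasDerivAt_circleField hf).deriv

attribute [local instance] finrank_real_complex_fact'

theorem contMDiff_coe_circle : ContMDiff (𝓡 1) 𝓘(ℝ, ℂ) ∞ (fun x : Circle => (x : ℂ)) :=
  contMDiff_coe_sphere (E := ℂ)

theorem injective_mvfderiv_coe_circle (p : Circle) :
    Function.Injective (mvfderiv (𝓡 1) (fun x : Circle => (x : ℂ)) p) :=
  injective_mvfderiv_subtypeVal_sphere (E := ℂ) p

theorem mvfderiv_coe_circleField (p : Circle) :
    mvfderiv (𝓡 1) (fun x : Circle => (x : ℂ)) p (circleField p) = Complex.I * p := by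
  have h1 := hasDerivAt_circleField (contMDiff_coe_circle.mdifferentiableAt (x := p) (by simp))
  have h2 : HasDerivAt (fun t : ℝ => (p : ℂ) * Complex.exp (t * Complex.I))
      ((p : ℂ) * (Complex.exp ((0 : ℝ) * Complex.I) * (1 * Complex.I))) 0 :=
    ((((hasDerivAt_id (0 : ℝ)).ofReal_comp).mul_const Complex.I).cexp).const_mul (p : ℂ)
  have h3 : (fun t : ℝ => ((p * Circle.exp t : Circle) : ℂ))
      = fun t : ℝ => (p : ℂ) * Complex.exp (t * Complex.I) := by
    funext t; simp [Circle.coe_exp]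
  rw [h3] at h1
  exact (h1.unique h2).trans (by simp [mul_comm])

theorem circleForm_circleField (p : Circle) : circleForm p (circleField p) = 1 := by
  rw [circleForm, ContinuousLinearMap.comp_apply, mvfderiv_coe_circleField,
    innerSL_apply_apply, real_inner_self_eq_norm_sq, norm_mul, Complex.norm_I]
  exact (congrArg (fun r => (1 * r) ^ 2) (Circle.norm_coe p)).trans (by norm_num)

end Circle

/-! ### The unit quaternions -/

section ThreeSphere

open scoped Quaternion

theorem re_imUnit (i : Fin 3) : (imUnit i).re = 0 := by fin_cases i <;> rfl
theorem imI_imUnit (i : Fin 3) : (imUnit i).imI = if i = 0 then 1 else 0 := by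
  fin_cases i <;> simp [imUnit]
theorem imJ_imUnit (i : Fin 3) : (imUnit i).imJ = if i = 1 then 1 else 0 := by
  fin_cases i <;> simp [imUnit]
theorem imK_imUnit (i : Fin 3) : (imUnit i).imK = if i = 2 then 1 else 0 := by
  fin_cases i <;> simp [imUnit]

theorem contMDiff_coe_S3 :
    ContMDiff (𝓡 3) 𝓘(ℝ, Quaternion ℝ) ∞ (fun y : S3 => (y : Quaternion ℝ)) :=
  contMDiff_coe_sphere

theorem injective_mvfderiv_coe_S3 (q : S3) :
    Function.Injective (mvfderiv (𝓡 3) (fun y : S3 => (y : Quaternion ℝ)) q) :=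
  injective_mvfderiv_subtypeVal_sphere q

theorem normSq_coe_S3 (q : S3) : Quaternion.normSq (q : Quaternion ℝ) = 1 := by
  have : ‖(q : Quaternion ℝ)‖ = 1 := by simp
  rw [Quaternion.normSq_eq_norm_mul_self, this]; norm_num

/-- The right translations `(t, q) ↦ q (cos t - sin t e_i)` of the unit quaternions. -/
def sphereFlow (i : Fin 3) (x : ℝ × S3) : S3 :=
  ⟨(x.2 : Quaternion ℝ) * ((Real.cos x.1 : Quaternion ℝ) - Real.sin x.1 • imUnit i), by
    have h1 : ‖(x.2 : Quaternion ℝ)‖ = 1 := by simp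
    have h2 : ‖((Real.cos x.1 : Quaternion ℝ) - Real.sin x.1 • imUnit i)‖ = 1 := by
      have : Quaternion.normSq ((Real.cos x.1 : Quaternion ℝ) - Real.sin x.1 • imUnit i) = 1 := by
        rw [Quaternion.normSq_def']
        fin_cases i <;> simp [re_imUnit, imI_imUnit, imJ_imUnit, imK_imUnit]
      rw [Quaternion.normSq_eq_norm_mul_self] at this
      nlinarith [norm_nonneg ((Real.cos x.1 : Quaternion ℝ) - Real.sin x.1 • imUnit i)]
    simp [h1, h2]⟩

theorem sphereFlow_zero (i : Fin 3) (q : S3) : sphereFlow i (0, q) = q := by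
  ext1; simp [sphereFlow]

theorem contMDiff_sphereFlow (i : Fin 3) :
    ContMDiff (𝓘(ℝ, ℝ).prod (𝓡 3)) (𝓡 3) ∞ (sphereFlow i) := by
  apply ContMDiff.codRestrict_sphere
  have h1 : ContMDiff (𝓘(ℝ, ℝ).prod (𝓡 3)) 𝓘(ℝ, Quaternion ℝ) ∞
      (fun x : ℝ × S3 => (x.2 : Quaternion ℝ)) := contMDiff_coe_S3.comp contMDiff_snd
  have h3 : ContDiff ℝ ∞ (fun t : ℝ => (Real.cos t : Quaternion ℝ) - Real.sin t • imUnit i) := by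
    have : (fun t : ℝ => (Real.cos t : Quaternion ℝ) - Real.sin t • imUnit i)
        = fun t : ℝ => Real.cos t • (1 : Quaternion ℝ) - Real.sin t • imUnit i := by
      funext t; congr 1; ext <;> simp
    rw [this]
    exact (Real.contDiff_cos.smul contDiff_const).sub (Real.contDiff_sin.smul contDiff_const)
  have h2 : ContMDiff (𝓘(ℝ, ℝ).prod (𝓡 3)) 𝓘(ℝ, Quaternion ℝ) ∞
      (fun x : ℝ × S3 => (Real.cos x.1 : Quaternion ℝ) - Real.sin x.1 • imUnit i) :=
    h3.contMDiff.comp contMDiff_fst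
  have hm : ContMDiff (𝓘(ℝ, Quaternion ℝ).prod 𝓘(ℝ, Quaternion ℝ)) 𝓘(ℝ, Quaternion ℝ) ∞
      (fun z : Quaternion ℝ × Quaternion ℝ => z.1 * z.2) := by
    rw [← modelWithCornersSelf_prod, chartedSpaceSelf_prod]
    exact (contDiff_mul (𝔸 := Quaternion ℝ)).contMDiff
  exact hm.comp (h1.prodMk h2)

/-- The field `q ↦ -q e_i` on the unit quaternions, as the field of initial velocities of
`sphereFlow i`. -/
def sphereField (i : Fin 3) : (q : S3) → TangentSpace (𝓡 3) q :=
  velocityField (sphereFlow i) (sphereFlow_zero i)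

theorem smoothField_sphereField (i : Fin 3) : SmoothField (sphereField i) :=
  smoothField_velocityField _ (contMDiff_sphereFlow i)

theorem mvfderiv_coe_sphereField (i : Fin 3) (q : S3) :
    mvfderiv (𝓡 3) (fun y : S3 => (y : Quaternion ℝ)) q (sphereField i q)
      = -((q : Quaternion ℝ) * imUnit i) := by
  have h1 := hasDerivAt_velocityField (sphereFlow_zero i) (contMDiff_sphereFlow i)
    (contMDiff_coe_S3.mdifferentiableAt (x := q) (by simp))
  have h2 : HasDerivAt (fun t : ℝ => (q : Quaternion ℝ)
      * (Real.cos t • (1 : Quaternion ℝ) - Real.sin t • imUnit i))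
      ((q : Quaternion ℝ) * ((-Real.sin 0) • (1 : Quaternion ℝ) - Real.cos 0 • imUnit i)) 0 :=
    (((Real.hasDerivAt_cos 0).smul_const _).sub ((Real.hasDerivAt_sin 0).smul_const _)).const_mul _
  have h3 : (fun t : ℝ => (sphereFlow i (t, q) : Quaternion ℝ)) = fun t : ℝ => (q : Quaternion ℝ)
      * (Real.cos t • (1 : Quaternion ℝ) - Real.sin t • imUnit i) := by
    funext t
    simp only [sphereFlow]
    congr 2
    ext <;> simp
  rw [h3] at h1
  exact (h1.unique h2).trans (by simp)

/-- The one-form dual to `q ↦ -q e_i` on the unit quaternions. -/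
def sphereForm (i : Fin 3) (q : S3) : TangentSpace (𝓡 3) q →L[ℝ] ℝ :=
  (innerSL ℝ (-((q : Quaternion ℝ) * imUnit i))).comp
    (mvfderiv (𝓡 3) (fun y : S3 => (y : Quaternion ℝ)) q)

theorem sphereForm_sphereField (i j : Fin 3) (q : S3) :
    sphereForm i q (sphereField j q) = if i = j then 1 else 0 := by
  rw [sphereForm, ContinuousLinearMap.comp_apply, mvfderiv_coe_sphereField, innerSL_apply_apply,
    Quaternion.inner_def]
  have h := normSq_coe_S3 q
  rw [Quaternion.normSq_def'] at h
  fin_cases i <;> fin_cases j <;>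
    simp [re_imUnit, imI_imUnit, imJ_imUnit, imK_imUnit] <;> linarith

theorem imUnit_commutator (i j : Fin 3) :
    imUnit i * imUnit j - imUnit j * imUnit i = (2 : ℝ) • ∑ k, eps i j k • imUnit k := by
  fin_cases i <;> fin_cases j <;> simp only [Fin.sum_univ_three] <;>
    ext <;> simp [re_imUnit, imI_imUnit, imJ_imUnit, imK_imUnit, eps] <;> norm_num

theorem mlieBracket_sphereField (i j : Fin 3) (q : S3) :
    VectorField.mlieBracket (𝓡 3) (sphereField i) (sphereField j) q
      = (-2 : ℝ) • ∑ k, eps i j k • sphereField k q := by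
  have hne : sphereField 0 q ≠ 0 := by
    intro h
    have := sphereForm_sphereField 0 0 q
    simp [h] at this
  -- compare the derivatives of the embedding in the quaternions along both sides
  apply injective_mvfderiv_coe_S3 q
  rw [(smoothField_sphereField i).mvfderiv_mlieBracket_vector (smoothField_sphereField j)
    (smoothField_sphereField 0) hne contMDiff_coe_S3]
  simp only [mvfderiv_coe_sphereField]
  have hd : ∀ i j : Fin 3, mvfderiv (𝓡 3) (fun y : S3 => -((y : Quaternion ℝ) * imUnit j)) q
      (sphereField i q) = (q : Quaternion ℝ) * imUnit i * imUnit j := by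
    intro i j
    have h1 := mvfderiv_clm_comp (-(ContinuousLinearMap.mul ℝ (Quaternion ℝ)).flip (imUnit j))
      (contMDiff_coe_S3.mdifferentiableAt (x := q) (by simp)) (sphereField i q)
    rw [mvfderiv_coe_sphereField] at h1
    refine Eq.trans ?_ (h1.trans ?_)
    · rfl
    · simp
  rw [hd, hd, map_smul, map_sum]
  simp only [map_smul, mvfderiv_coe_sphereField]
  rw [mul_assoc, mul_assoc, ← mul_sub, imUnit_commutator]
  simp [Finset.mul_sum]

/-- The frame `q ↦ -q e_i` on the unit quaternions. -/
def sphereFrame : MilnorFrame where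
  frame := sphereField
  coframe := sphereForm
  smooth := smoothField_sphereField
  dual := sphereForm_sphereField
  bracket := mlieBracket_sphereField

theorem MilnorFrame.isDualFrame (F : MilnorFrame) : IsDualFrame F.frame F.coframe :=
  .of_card F.smooth F.dual (by simp)

theorem MilnorFrame.bracket_eq_sum (F : MilnorFrame) (i j : Fin 3) (q : S3) :
    VectorField.mlieBracket (𝓡 3) (F.frame i) (F.frame j) q
      = ∑ k, (-2 * eps i j k) • F.frame k q := by
  rw [F.bracket, Finset.smul_sum]
  simp only [smul_smul]

end ThreeSphere

/-! ### The product frame -/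

section Product

variable (F : MilnorFrame)

theorem prodFrame_zero (x : Circle × S3) : prodFrame F 0 x = (circleField x.1, 0) := by
  simp only [prodFrame, Fin.cons_zero]
  rw [mfderiv_prod_left]
  rfl

theorem prodFrame_succ (i : Fin 3) (x : Circle × S3) :
    prodFrame F i.succ x = (0, F.frame i x.2) := by
  simp only [prodFrame, Fin.cons_succ]
  rw [mfderiv_prod_right]
  rfl

theorem prodCoframe_zero (x : Circle × S3) (v : TangentSpace ((𝓡 1).prod (𝓡 3)) x) :
    prodCoframe F 0 x v = circleForm x.1 v.1 := by
  simp only [prodCoframe, Fin.cons_zero, ContinuousLinearMap.comp_apply]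
  rw [mfderiv_fst]
  rfl

theorem prodCoframe_succ (i : Fin 3) (x : Circle × S3)
    (v : TangentSpace ((𝓡 1).prod (𝓡 3)) x) :
    prodCoframe F i.succ x v = F.coframe i x.2 v.2 := by
  simp only [prodCoframe, Fin.cons_succ, ContinuousLinearMap.comp_apply]
  rw [mfderiv_snd]
  rfl

theorem smoothField_prodFrame (α : Fin 4) : SmoothField (prodFrame F α) := by
  refine Fin.cases ?_ (fun i => ?_) α
  · have h : (fun x => (⟨x, prodFrame F 0 x⟩ : TangentBundle ((𝓡 1).prod (𝓡 3)) (Circle × S3)))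
        = (equivTangentBundleProd (𝓡 1) Circle (𝓡 3) S3).symm ∘ fun x : Circle × S3 =>
          ((⟨x.1, circleField x.1⟩ : TangentBundle (𝓡 1) Circle),
            (⟨x.2, 0⟩ : TangentBundle (𝓡 3) S3)) := by
      funext x; rw [prodFrame_zero]; rfl
    unfold SmoothField
    rw [h]
    exact contMDiff_equivTangentBundleProd_symm.comp
      ((smoothField_circleField.comp contMDiff_fst).prodMk
        ((contMDiff_zeroSection ℝ (TangentSpace (𝓡 3) : S3 → Type _)).comp contMDiff_snd))
  · have h : (fun x => (⟨x, prodFrame F i.succ x⟩ :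
          TangentBundle ((𝓡 1).prod (𝓡 3)) (Circle × S3)))
        = (equivTangentBundleProd (𝓡 1) Circle (𝓡 3) S3).symm ∘ fun x : Circle × S3 =>
          ((⟨x.1, 0⟩ : TangentBundle (𝓡 1) Circle),
            (⟨x.2, F.frame i x.2⟩ : TangentBundle (𝓡 3) S3)) := by
      funext x; rw [prodFrame_succ]; rfl
    unfold SmoothField
    rw [h]
    exact contMDiff_equivTangentBundleProd_symm.comp
      (((contMDiff_zeroSection ℝ (TangentSpace (𝓡 1) : Circle → Type _)).comp contMDiff_fst).prodMk
        ((F.smooth i).comp contMDiff_snd))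

theorem prodCoframe_prodFrame (α β : Fin 4) (x : Circle × S3) :
    prodCoframe F α x (prodFrame F β x) = if α = β then 1 else 0 := by
  refine Fin.cases ?_ (fun i => ?_) α <;> refine Fin.cases ?_ (fun j => ?_) β
  · rw [prodCoframe_zero, prodFrame_zero]
    simpa using circleForm_circleField x.1
  · rw [prodCoframe_zero, prodFrame_succ, if_neg (Fin.succ_ne_zero j).symm]
    exact map_zero _
  · rw [prodCoframe_succ, prodFrame_zero, if_neg (Fin.succ_ne_zero i)]
    exact map_zero _
  · rw [prodCoframe_succ, prodFrame_succ]
    simpa using F.dual i j x.2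

theorem isDualFrame_prodFrame : IsDualFrame (prodFrame F) (prodCoframe F) :=
  .of_card (smoothField_prodFrame F) (prodCoframe_prodFrame F) (by simp)

/-- The structure constants of the frame `∂_z, E_1, E_2, E_3`. -/
def prodStructure (α β γ : Fin 4) : ℝ :=
  Fin.cases 0 (fun i => Fin.cases 0 (fun j => Fin.cases 0 (fun k => -2 * eps i j k) γ) β) α

section Derivatives

variable {V : Type*} [NormedAddCommGroup V] [NormedSpace ℝ V]

theorem mvfderiv_comp_fst {u : Circle → V} {x : Circle × S3} (hu : MDiffAt u x.1)
    (v : TangentSpace ((𝓡 1).prod (𝓡 3)) x) :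
    mvfderiv ((𝓡 1).prod (𝓡 3)) (fun y : Circle × S3 => u y.1) x v = mvfderiv (𝓡 1) u x.1 v.1 := by
  have h := mfderiv_comp_apply (I' := 𝓡 1) (g := u) (f := (Prod.fst : Circle × S3 → Circle)) x hu
    mdifferentiableAt_fst v
  rw [mfderiv_fst] at h
  exact h

theorem mvfderiv_comp_snd {u : S3 → V} {x : Circle × S3} 
    (hu : MDifferentiableAt (𝓡 3) 𝓘(ℝ, V) u x.2)
    (v : TangentSpace ((𝓡 1).prod (𝓡 3)) x) :
    mvfderiv ((𝓡 1).prod (𝓡 3)) (fun y : Circle × S3 => u y.2) x v = mvfderiv (𝓡 3) u x.2 v.2 := by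
  have h := mfderiv_comp_apply (I' := 𝓡 3) (g := u) (f := (Prod.snd : Circle × S3 → S3)) x hu
    mdifferentiableAt_snd v
  rw [mfderiv_snd] at h
  exact h

end Derivatives

/-- A tangent vector of the product is determined by the derivatives of the two embeddings
`S¹ ⊆ ℂ` and `S³ ⊆ ℍ` along it. -/
theorem tangent_prod_ext {x : Circle × S3} {v w : TangentSpace ((𝓡 1).prod (𝓡 3)) x}
    (h1 : mvfderiv (𝓡 1) (fun p : Circle => (p : ℂ)) x.1 v.1
      = mvfderiv (𝓡 1) (fun p : Circle => (p : ℂ)) x.1 w.1)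
    (h2 : mvfderiv (𝓡 3) (fun q : S3 => (q : Quaternion ℝ)) x.2 v.2
      = mvfderiv (𝓡 3) (fun q : S3 => (q : Quaternion ℝ)) x.2 w.2) : v = w :=
  Prod.ext (injective_mvfderiv_coe_circle x.1 h1) (injective_mvfderiv_coe_S3 x.2 h2)

/-- `∂_z` commutes with the `E_i`. -/
theorem mlieBracket_prodFrame (α β : Fin 4) (x : Circle × S3) :
    VectorField.mlieBracket ((𝓡 1).prod (𝓡 3)) (prodFrame F α) (prodFrame F β) x
      = ∑ γ, prodStructure α β γ • prodFrame F γ x := by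
  have hC : ∀ p : Circle, MDifferentiableAt (𝓡 1) 𝓘(ℝ, ℂ) (fun p : Circle => (p : ℂ)) p :=
    fun p => contMDiff_coe_circle.mdifferentiableAt (by simp)
  have hS : ∀ q : S3,
      MDifferentiableAt (𝓡 3) 𝓘(ℝ, Quaternion ℝ) (fun q : S3 => (q : Quaternion ℝ)) q :=
    fun q => contMDiff_coe_S3.mdifferentiableAt (by simp)
  have h0 := (isDualFrame_prodFrame F).frame_ne_zero 0 x
  have hs := smoothField_prodFrame F
  have hfst := (hs α).mvfderiv_mlieBracket_vector (hs β) (hs 0) h0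
    (f := fun y : Circle × S3 => (y.1 : ℂ)) (contMDiff_coe_circle.comp contMDiff_fst)
  have hsnd := (hs α).mvfderiv_mlieBracket_vector (hs β) (hs 0) h0
    (f := fun y : Circle × S3 => (y.2 : Quaternion ℝ)) (contMDiff_coe_S3.comp contMDiff_snd)
  have hSf : ∀ j q, MDifferentiableAt (𝓡 3) 𝓘(ℝ, Quaternion ℝ)
      (fun q : S3 => mvfderiv (𝓡 3) (fun q : S3 => (q : Quaternion ℝ)) q (F.frame j q)) q :=
    fun j q => ((F.smooth j).contMDiff_mvfderiv contMDiff_coe_S3).mdifferentiableAt (by simp)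
  have hCf : ∀ p, MDifferentiableAt (𝓡 1) 𝓘(ℝ, ℂ)
      (fun p : Circle => mvfderiv (𝓡 1) (fun p : Circle => (p : ℂ)) p (circleField p)) p :=
    fun p => (smoothField_circleField.contMDiff_mvfderiv contMDiff_coe_circle).mdifferentiableAt
      (by simp)
  -- derivatives of the embeddings along the frame
  have e0 : ∀ y : Circle × S3, mvfderiv ((𝓡 1).prod (𝓡 3)) (fun y : Circle × S3 => (y.1 : ℂ)) y
      (prodFrame F 0 y) = mvfderiv (𝓡 1) (fun p : Circle => (p : ℂ)) y.1 (circleField y.1) :=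
    fun y => by rw [mvfderiv_comp_fst (hC _), prodFrame_zero]
  have e0' : ∀ y : Circle × S3, mvfderiv ((𝓡 1).prod (𝓡 3))
      (fun y : Circle × S3 => (y.2 : Quaternion ℝ)) y (prodFrame F 0 y) = 0 :=
    fun y => by rw [mvfderiv_comp_snd (hS _), prodFrame_zero]; exact map_zero _
  have es : ∀ i (y : Circle × S3), mvfderiv ((𝓡 1).prod (𝓡 3))
      (fun y : Circle × S3 => (y.1 : ℂ)) y (prodFrame F (Fin.succ i) y) = 0 :=
    fun i y => by rw [mvfderiv_comp_fst (hC _), prodFrame_succ]; exact map_zero _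
  have es' : ∀ i (y : Circle × S3), mvfderiv ((𝓡 1).prod (𝓡 3))
      (fun y : Circle × S3 => (y.2 : Quaternion ℝ)) y (prodFrame F (Fin.succ i) y)
        = mvfderiv (𝓡 3) (fun q : S3 => (q : Quaternion ℝ)) y.2 (F.frame i y.2) :=
    fun i y => by rw [mvfderiv_comp_snd (hS _), prodFrame_succ]
  have hz : ∀ (V : Type) [NormedAddCommGroup V] [NormedSpace ℝ V],
      mvfderiv ((𝓡 1).prod (𝓡 3)) (fun _ : Circle × S3 => (0 : V)) x = 0 :=
    fun V _ _ => mvfderiv_const 0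
  -- derivatives along the other factor vanish
  have kC : ∀ i : Fin 3, mvfderiv ((𝓡 1).prod (𝓡 3)) (fun y : Circle × S3 =>
      mvfderiv (𝓡 1) (fun p : Circle => (p : ℂ)) y.1 (circleField y.1)) x
        (prodFrame F i.succ x) = 0 := fun i => by
    rw [mvfderiv_comp_fst (hCf _), prodFrame_succ]; exact map_zero _
  have kS : ∀ i : Fin 3, mvfderiv ((𝓡 1).prod (𝓡 3)) (fun y : Circle × S3 =>
      mvfderiv (𝓡 3) (fun q : S3 => (q : Quaternion ℝ)) y.2 (F.frame i y.2)) x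
        (prodFrame F 0 x) = 0 := fun i => by
    rw [mvfderiv_comp_snd (hSf _ _), prodFrame_zero]; exact map_zero _
  have kS' : ∀ i j : Fin 3, mvfderiv ((𝓡 1).prod (𝓡 3)) (fun y : Circle × S3 =>
      mvfderiv (𝓡 3) (fun q : S3 => (q : Quaternion ℝ)) y.2 (F.frame j y.2)) x
        (prodFrame F i.succ x)
      = mvfderiv (𝓡 3) (fun y : S3 => mvfderiv (𝓡 3) (fun q : S3 => (q : Quaternion ℝ)) y
          (F.frame j y)) x.2 (F.frame i x.2) := fun i j => by
    rw [mvfderiv_comp_snd (hSf _ _), prodFrame_succ]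
  refine tangent_prod_ext ?_ ?_
  · rw [← mvfderiv_comp_fst (hC _), ← mvfderiv_comp_fst (hC _), hfst, map_sum, Fin.sum_univ_succ]
    simp only [map_smul, es]
    clear hfst hsnd
    induction α using Fin.cases <;> induction β using Fin.cases <;>
      simp [prodStructure, es, e0, hz, kC]
  · rw [← mvfderiv_comp_snd (hS _), ← mvfderiv_comp_snd (hS _), hsnd, map_sum, Fin.sum_univ_succ]
    simp only [map_smul, e0', es']
    clear hfst hsnd
    induction α using Fin.cases with
    | zero => induction β using Fin.cases <;> simp [prodStructure, es', e0', hz, kS]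
    | succ i =>
      induction β using Fin.cases with
      | zero => simp [prodStructure, es', e0', hz, kS]
      | succ j =>
        have h := (F.smooth i).mvfderiv_mlieBracket_vector (F.smooth j) (F.smooth 0)
          (F.isDualFrame.frame_ne_zero 0 x.2) contMDiff_coe_S3
        rw [F.bracket_eq_sum] at h
        simp only [es', kS']
        rw [← h]
        simp [prodStructure]

end Product

/-! ### Metrics depending on `z` only -/

section CircleDerivative

theorem hasDerivAt_ddz {f : Circle → ℝ} (hf : ContMDiff (𝓡 1) 𝓘(ℝ, ℝ) ∞ f) (p : Circle) :
    HasDerivAt (fun t : ℝ => f (p * Circle.exp t)) (ddz f p) 0 := by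
  rw [ddz_eq_mvfderiv (hf.mdiffAt _)]
  exact hasDerivAt_circleField (hf.mdiffAt _)

theorem contMDiff_ddz {f : Circle → ℝ} (hf : ContMDiff (𝓡 1) 𝓘(ℝ, ℝ) ∞ f) :
    ContMDiff (𝓡 1) 𝓘(ℝ, ℝ) ∞ (ddz f) := by
  have h : ddz f = fun p => mvfderiv (𝓡 1) f p (circleField p) :=
    funext fun p => ddz_eq_mvfderiv (hf.mdiffAt _)
  rw [h]
  exact smoothField_circleField.contMDiff_mvfderiv hf

end CircleDerivative

section WarpedAlgebra

/-- The structure constants as a polynomial in the indices, for evaluation at numerals. -/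
theorem prodStructure_eq (α β γ : Fin 4) :
    prodStructure α β γ = if α = 0 ∨ β = 0 ∨ γ = 0 then 0 else
      -(((β.val : ℝ) - α.val) * ((γ.val : ℝ) - β.val) * ((γ.val : ℝ) - α.val)) := by
  induction α using Fin.cases <;> induction β using Fin.cases <;> induction γ using Fin.cases <;>
    simp [prodStructure, eps]
  ring

/-- Twice the Koszul symbols of `∑ α, u α • θ^α ⊗ θ^α` with lowered last index, in the frame
`∂_z, E_1, E_2, E_3`, where `u'` is the `z`-derivative of `u`. -/
def warpNum (u u' : Fin 4 → ℝ) (α β γ : Fin 4) : ℝ :=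
  (if β = γ then (if α = 0 then u' β else 0) else 0)
    + (if α = γ then (if β = 0 then u' α else 0) else 0)
    - (if α = β then (if γ = 0 then u' α else 0) else 0)
    + prodStructure α β γ * u γ - prodStructure α γ β * u β - prodStructure β γ α * u α

/-- The symbols of `∑ α, u α • θ^α ⊗ θ^α` in the frame `∂_z, E_1, E_2, E_3`, where `u'` is the
`z`-derivative of `u`. -/
def warpSymbol (u u' : Fin 4 → ℝ) (α β γ : Fin 4) : ℝ :=
  1 / 2 * (u γ)⁻¹ * warpNum u u' α β γ

/-- The `z`-derivative of `warpSymbol u u'`, where `u'` and `u''` are the first two derivatives of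
`u`; note that `warpNum` is linear in `u` and `u'` jointly. -/
def warpSymbolDeriv (u u' u'' : Fin 4 → ℝ) (α β γ : Fin 4) : ℝ :=
  -(u' γ * (u γ)⁻¹) * warpSymbol u u' α β γ + 1 / 2 * (u γ)⁻¹ * warpNum u' u'' α β γ

/-- The curvature components `R_{αβγ}^δ` of `∑ α, u α • θ^α ⊗ θ^α` in the frame
`∂_z, E_1, E_2, E_3`, as functions of the 2-jet `(u, u', u'')` of `u`. -/
def warpCurv (u u' u'' : Fin 4 → ℝ) (α β γ δ : Fin 4) : ℝ :=
  (if α = 0 then warpSymbolDeriv u u' u'' β γ δ else 0)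
    - (if β = 0 then warpSymbolDeriv u u' u'' α γ δ else 0)
    - ∑ μ, prodStructure α β μ * warpSymbol u u' μ γ δ
    + ∑ ν, (warpSymbol u u' α ν δ * warpSymbol u u' β γ ν
      - warpSymbol u u' β ν δ * warpSymbol u u' α γ ν)

theorem hasDerivAt_warpSymbol {u u' : ℝ → Fin 4 → ℝ} {v w : Fin 4 → ℝ} {t : ℝ}
    (hu : ∀ α, HasDerivAt (fun s => u s α) (v α) t)
    (hu' : ∀ α, HasDerivAt (fun s => u' s α) (w α) t) (h0 : ∀ α, u t α ≠ 0)
    (hv : ∀ α, v α = u' t α) (α β γ : Fin 4) :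
    HasDerivAt (fun s => warpSymbol (u s) (u' s) α β γ)
      (warpSymbolDeriv (u t) (u' t) w α β γ) t := by
  have hif : ∀ (P Q : Prop) [Decidable P] [Decidable Q] (μ : Fin 4),
      HasDerivAt (fun s => if P then (if Q then u' s μ else 0) else 0)
        (if P then (if Q then w μ else 0) else 0) t := by
    intro P Q _ _ μ
    by_cases hP : P <;> by_cases hQ : Q <;> simp [hP, hQ, hu', hasDerivAt_const]
  have hn : HasDerivAt (fun s => warpNum (u s) (u' s) α β γ) (warpNum v w α β γ) t :=
    (((((hif _ _ _).add (hif _ _ _)).sub (hif _ _ _)).add ((hu γ).const_mul _)).sub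
      ((hu β).const_mul _)).sub ((hu α).const_mul _)
  have hv' : v = u' t := funext hv
  refine ((((hu γ).inv (h0 γ)).const_mul (1 / 2)).mul hn).congr_deriv ?_
  have := h0 γ
  rw [hv', warpSymbolDeriv, warpSymbol]
  simp only [Pi.inv_apply]
  field_simp

end WarpedAlgebra

/-! ### The symbols and the curvature of the ansatz -/

section Ansatz

variable (F : MilnorFrame) {φ : Circle → ℝ} {a : Fin 3 → Circle → ℝ}

theorem ansatzMetric_eq_frameMetric (φ : Circle → ℝ) (a : Fin 3 → Circle → ℝ) :
    ansatzMetric F φ a = frameMetric (prodCoframe F) (fun α x => gLow φ a α x.1) := by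
  funext x
  rw [frameMetric, Fin.sum_univ_succ]
  rfl

theorem fibreMetric_eq_frameMetric (c : Fin 3 → ℝ) :
    fibreMetric F c = frameMetric F.coframe (fun i _ => c i ^ 2) := rfl

theorem IsAnsatz.contMDiff_gLow (h : IsAnsatz φ a) (α : Fin 4) :
    ContMDiff (𝓡 1) 𝓘(ℝ, ℝ) ∞ (gLow φ a α) := by
  induction α using Fin.cases with
  | zero => exact h.smooth_φ.pow 2
  | succ i => exact (h.smooth_a i).pow 2

theorem IsAnsatz.gLow_pos (h : IsAnsatz φ a) (α : Fin 4) (p : Circle) : 0 < gLow φ a α p := by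
  induction α using Fin.cases with
  | zero => exact pow_pos (h.pos_φ p) 2
  | succ i => exact pow_pos (h.pos_a i p) 2

theorem IsAnsatz.contMDiff_gLow_fst (h : IsAnsatz φ a) (α : Fin 4) :
    ContMDiff ((𝓡 1).prod (𝓡 3)) 𝓘(ℝ, ℝ) ∞ (fun x : Circle × S3 => gLow φ a α x.1) :=
  (h.contMDiff_gLow α).comp contMDiff_fst

theorem mvfderiv_comp_fst_prodFrame {f : Circle → ℝ} (hf : ContMDiff (𝓡 1) 𝓘(ℝ, ℝ) ∞ f)
    (α : Fin 4) (x : Circle × S3) :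
    mvfderiv ((𝓡 1).prod (𝓡 3)) (fun y : Circle × S3 => f y.1) x (prodFrame F α x)
      = if α = 0 then ddz f x.1 else 0 := by
  rw [mvfderiv_comp_fst (hf.mdiffAt _)]
  induction α using Fin.cases with
  | zero => rw [prodFrame_zero, if_pos rfl, ddz_eq_mvfderiv (hf.mdiffAt _)]
  | succ i => rw [prodFrame_succ, if_neg (Fin.succ_ne_zero i)]; exact map_zero _

theorem IsAnsatz.koszul_eq (h : IsAnsatz φ a) (α β γ : Fin 4) :
    koszul (prodFrame F) (fun α x => gLow φ a α x.1) prodStructure α β γ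
      = fun x : Circle × S3 => warpSymbol (fun μ => gLow φ a μ x.1)
        (fun μ => ddz (gLow φ a μ) x.1) α β γ := by
  funext x
  simp only [koszul, mvfderiv_comp_fst_prodFrame F (h.contMDiff_gLow _)]
  rfl

theorem IsAnsatz.curvComp_eq (h : IsAnsatz φ a) (α β γ δ : Fin 4) (x : Circle × S3) :
    curvComp (prodFrame F) (koszul (prodFrame F) (fun α x => gLow φ a α x.1) prodStructure)
        prodStructure α β γ δ x
      = warpCurv (fun μ => gLow φ a μ x.1) (fun μ => ddz (gLow φ a μ) x.1)
          (fun μ => ddz (ddz (gLow φ a μ)) x.1) α β γ δ := by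
  have hs : ∀ α β γ, ContMDiff (𝓡 1) 𝓘(ℝ, ℝ) ∞ (fun p => warpSymbol (fun μ => gLow φ a μ p)
      (fun μ => ddz (gLow φ a μ) p) α β γ) := by
    intro α β γ
    have hif : ∀ (P Q : Prop) [Decidable P] [Decidable Q] (μ : Fin 4),
        ContMDiff (𝓡 1) 𝓘(ℝ, ℝ) ∞
          (fun p => if P then (if Q then ddz (gLow φ a μ) p else 0) else 0) := by
      intro P Q _ _ μ
      by_cases hP : P <;> by_cases hQ : Q <;>
        simp [hP, hQ, contMDiff_const, contMDiff_ddz (h.contMDiff_gLow μ)]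
    have hm : ∀ (r : ℝ) (μ : Fin 4), ContMDiff (𝓡 1) 𝓘(ℝ, ℝ) ∞ (fun p => r * gLow φ a μ p) :=
      fun r μ => contMDiff_const.mul (h.contMDiff_gLow μ)
    exact (contMDiff_const.mul ((h.contMDiff_gLow γ).inv₀ fun p => (h.gLow_pos γ p).ne')).mul
      ((((((hif _ _ _).add (hif _ _ _)).sub (hif _ _ _)).add (hm _ γ)).sub
        (hm _ β)).sub (hm _ α))
  have hd : ∀ α β γ, ddz (fun p => warpSymbol (fun μ => gLow φ a μ p)
      (fun μ => ddz (gLow φ a μ) p) α β γ) x.1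
        = warpSymbolDeriv (fun μ => gLow φ a μ x.1) (fun μ => ddz (gLow φ a μ) x.1)
          (fun μ => ddz (ddz (gLow φ a μ)) x.1) α β γ := by
    intro α β γ
    have := hasDerivAt_warpSymbol (t := 0) (u := fun s μ => gLow φ a μ (x.1 * Circle.exp s))
      (u' := fun s μ => ddz (gLow φ a μ) (x.1 * Circle.exp s))
      (fun μ => hasDerivAt_ddz (h.contMDiff_gLow μ) x.1)
      (fun μ => hasDerivAt_ddz (contMDiff_ddz (h.contMDiff_gLow μ)) x.1)
      (fun μ => (h.gLow_pos μ _).ne') (fun μ => by simp) α β γ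
    refine Eq.trans this.deriv ?_
    simp
  simp only [curvComp, h.koszul_eq, mvfderiv_comp_fst_prodFrame F (hs _ _ _), hd]
  rfl

variable (x : Circle × S3)

theorem IsAnsatz.isLeviCivita (h : IsAnsatz φ a) :
    IsLeviCivita (ansatzMetric F φ a) (leviCivita (ansatzMetric F φ a)) := by
  rw [ansatzMetric_eq_frameMetric]
  exact (isDualFrame_prodFrame F).isLeviCivita_leviCivita (mlieBracket_prodFrame F)
    h.contMDiff_gLow_fst (fun α x => (h.gLow_pos α x.1).ne')

theorem IsAnsatz.isCurvatureTensor (h : IsAnsatz φ a) :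
    IsCurvatureTensor (leviCivita (ansatzMetric F φ a)) (curvature (ansatzMetric F φ a)) := by
  rw [ansatzMetric_eq_frameMetric]
  exact (isDualFrame_prodFrame F).isCurvatureTensor_curvature (mlieBracket_prodFrame F)
    h.contMDiff_gLow_fst (fun α x => (h.gLow_pos α x.1).ne')

theorem ansatzMetric_prodFrame (φ : Circle → ℝ) (a : Fin 3 → Circle → ℝ) (α β : Fin 4) :
    ansatzMetric F φ a x (prodFrame F α x) (prodFrame F β x)
      = if α = β then gLow φ a α x.1 else 0 := by
  rw [ansatzMetric_eq_frameMetric, (isDualFrame_prodFrame F).frameMetric_frame]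

theorem IsAnsatz.sig_eq (h : IsAnsatz φ a) (α β γ : Fin 4) :
    Sig F φ a x α β γ
      = warpSymbol (fun μ => gLow φ a μ x.1) (fun μ => ddz (gLow φ a μ) x.1) α β γ := by
  rw [Sig, ansatzMetric_eq_frameMetric, (isDualFrame_prodFrame F).frameSymbol_eq_koszul
    (mlieBracket_prodFrame F) h.contMDiff_gLow_fst
    (fun α x => (h.gLow_pos α x.1).ne'), h.koszul_eq]

theorem IsAnsatz.rmC_eq (h : IsAnsatz φ a) (α β γ δ : Fin 4) :
    RmC F φ a x α β γ δ = gLow φ a δ x.1 * warpCurv (fun μ => gLow φ a μ x.1)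
      (fun μ => ddz (gLow φ a μ) x.1) (fun μ => ddz (ddz (gLow φ a μ)) x.1) α β γ δ := by
  rw [RmC, ansatzMetric_eq_frameMetric, (isDualFrame_prodFrame F).Rm_frame
    (mlieBracket_prodFrame F) h.contMDiff_gLow_fst
    (fun α x => (h.gLow_pos α x.1).ne'), h.curvComp_eq]

theorem IsAnsatz.ricC_eq (h : IsAnsatz φ a) (β γ : Fin 4) :
    RicC F φ a x β γ = ∑ α, warpCurv (fun μ => gLow φ a μ x.1)
      (fun μ => ddz (gLow φ a μ) x.1) (fun μ => ddz (ddz (gLow φ a μ)) x.1) α β γ α := by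
  rw [RicC, ansatzMetric_eq_frameMetric, (isDualFrame_prodFrame F).ricci_frame
    (mlieBracket_prodFrame F) h.contMDiff_gLow_fst
    (fun α x => (h.gLow_pos α x.1).ne')]
  simp only [h.curvComp_eq]

theorem kC_eq (φ : Circle → ℝ) (a : Fin 3 → Circle → ℝ) {α β : Fin 4} (hαβ : α ≠ β) :
    KC F φ a x α β = RmC F φ a x α β β α / (gLow φ a α x.1 * gLow φ a β x.1) := by
  rw [KC, sectional, RmC]
  simp [ansatzMetric_prodFrame, hαβ]

end Ansatz

/-! ### The fibre metric -/

section Fibre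

variable (F : MilnorFrame) {c : Fin 3 → ℝ}

theorem isLeviCivita_fibreMetric (hc : ∀ i, c i ≠ 0) :
    IsLeviCivita (fibreMetric F c) (leviCivita (fibreMetric F c)) :=
  F.isDualFrame.isLeviCivita_leviCivita F.bracket_eq_sum (fun _ => contMDiff_const)
    (fun i _ => pow_ne_zero 2 (hc i))

theorem isCurvatureTensor_fibreMetric (hc : ∀ i, c i ≠ 0) :
    IsCurvatureTensor (leviCivita (fibreMetric F c)) (curvature (fibreMetric F c)) :=
  F.isDualFrame.isCurvatureTensor_curvature F.bracket_eq_sum (fun _ => contMDiff_const)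
    (fun i _ => pow_ne_zero 2 (hc i))

theorem eps_swap (i j k : Fin 3) : eps i k j = - eps i j k := by
  simp only [eps]; ring

theorem eps_rotate (i j k : Fin 3) : eps j k i = eps i j k := by
  simp only [eps]; ring

/-- The fibre metric has constant components, so that its symbols are constant as well. -/
theorem koszul_fibre (c : Fin 3 → ℝ) (i j k : Fin 3) :
    koszul F.frame (fun i _ => c i ^ 2) (fun i j k => -2 * eps i j k) i j k
      = fun _ => eps i j k * (c k ^ 2)⁻¹ * (c i ^ 2 - c j ^ 2 - c k ^ 2) := by
  funext q
  simp only [koszul, mvfderiv_const, eps_swap i j k, eps_rotate i j k]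
  simp
  ring

theorem sigHat_eq (hc : ∀ i, c i ≠ 0) (q : S3) (i j k : Fin 3) :
    SigHat F c q i j k = eps i j k * (c k ^ 2)⁻¹ * (c i ^ 2 - c j ^ 2 - c k ^ 2) := by
  rw [SigHat, fibreMetric_eq_frameMetric, F.isDualFrame.frameSymbol_eq_koszul F.bracket_eq_sum
    (fun _ => contMDiff_const) (fun i _ => pow_ne_zero 2 (hc i)), koszul_fibre]

theorem rmHat_eq (hc : ∀ i, c i ≠ 0) (q : S3) {i j k : Fin 3} (hij : i ≠ j) (hjk : j ≠ k)
    (hik : i ≠ k) :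
    RmHat F c q i j j i = -(c k ^ 2)⁻¹ * ((c k ^ 2) ^ 2 - (c i ^ 2 - c j ^ 2) ^ 2)
      - 2 * (c k ^ 2 - c j ^ 2 - c i ^ 2) := by
  rw [RmHat, fibreMetric_eq_frameMetric, F.isDualFrame.Rm_frame F.bracket_eq_sum
    (fun _ => contMDiff_const) (fun i _ => pow_ne_zero 2 (hc i))]
  simp only [curvComp, koszul_fibre, mvfderiv_const, Fin.sum_univ_three]
  have h0 := hc 0
  have h1 := hc 1
  have h2 := hc 2
  fin_cases i <;> fin_cases j <;> fin_cases k <;> simp at hij hjk hik <;> simp [eps] <;>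
    field_simp <;> ring

theorem kHat_eq (q : S3) {i j : Fin 3} (hij : i ≠ j) :
    KHat F c q i j = RmHat F c q i j j i / (c i ^ 2 * c j ^ 2) := by
  rw [KHat, sectional, RmHat]
  simp only [fibreMetric_eq_frameMetric, F.isDualFrame.frameMetric_frame]
  simp [hij]

end Fibre

/-! ### Evaluation of the symbols and of the curvature components -/

section WarpedFormulas

variable {u u' u'' : Fin 4 → ℝ}

theorem warpSymbol_zero_zero_zero : warpSymbol u u' 0 0 0 = 1 / 2 * (u 0)⁻¹ * u' 0 := by
  simp [warpSymbol, warpNum, prodStructure_eq]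

theorem warpSymbol_zero_succ_zero (i : Fin 3) : warpSymbol u u' 0 i.succ 0 = 0 := by
  simp [warpSymbol, warpNum, prodStructure_eq, (Fin.succ_ne_zero i).symm]

theorem warpSymbol_succ_zero_zero (i : Fin 3) : warpSymbol u u' i.succ 0 0 = 0 := by
  simp [warpSymbol, warpNum, prodStructure_eq]

theorem warpSymbol_zero_zero_succ (i : Fin 3) : warpSymbol u u' 0 0 i.succ = 0 := by
  simp [warpSymbol, warpNum, prodStructure_eq, (Fin.succ_ne_zero i).symm]

theorem warpSymbol_succ_zero_succ (i j : Fin 3) : warpSymbol u u' j.succ 0 i.succ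
    = if i = j then 1 / 2 * (u i.succ)⁻¹ * u' i.succ else 0 := by
  by_cases h : i = j
  · simp [warpSymbol, warpNum, prodStructure_eq, (Fin.succ_ne_zero _).symm, h]
  · simp [warpSymbol, warpNum, prodStructure_eq, (Fin.succ_ne_zero i).symm, h, Ne.symm h]

theorem warpSymbol_zero_succ_succ (i j : Fin 3) : warpSymbol u u' 0 j.succ i.succ
    = if i = j then 1 / 2 * (u i.succ)⁻¹ * u' i.succ else 0 := by
  by_cases h : i = j
  · simp [warpSymbol, warpNum, prodStructure_eq, (Fin.succ_ne_zero _).symm, h]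
  · simp [warpSymbol, warpNum, prodStructure_eq, (Fin.succ_ne_zero i).symm, h, Ne.symm h]

theorem warpSymbol_succ_succ_zero (i j : Fin 3) : warpSymbol u u' i.succ j.succ 0
    = if i = j then -(1 / 2) * (u 0)⁻¹ * u' i.succ else 0 := by
  by_cases h : i = j <;>
    simp [warpSymbol, warpNum, prodStructure_eq, h]

theorem warpSymbol_succ_succ_succ (i j k : Fin 3) : warpSymbol u u' i.succ j.succ k.succ
    = eps i j k * (u k.succ)⁻¹ * (u i.succ - u j.succ - u k.succ) := by
  simp only [warpSymbol, warpNum, prodStructure, Fin.cases_succ, Fin.succ_ne_zero, if_false,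
    ite_self, eps_swap i j k, eps_rotate i j k]
  ring

theorem prodStructure_zero_left (β γ : Fin 4) : prodStructure 0 β γ = 0 := by
  simp [prodStructure_eq]

theorem prodStructure_zero_mid (α γ : Fin 4) : prodStructure α 0 γ = 0 := by
  simp [prodStructure_eq]

theorem prodStructure_zero_right (α β : Fin 4) : prodStructure α β 0 = 0 := by
  simp [prodStructure_eq]

theorem prodStructure_succ (i j k : Fin 3) :
    prodStructure i.succ j.succ k.succ = -2 * eps i j k := rfl

theorem warpNum_succ_succ_succ (i j k : Fin 3) : warpNum u u' i.succ j.succ k.succ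
    = 2 * eps i j k * (u i.succ - u j.succ - u k.succ) := by
  simp only [warpNum, prodStructure, Fin.cases_succ, Fin.succ_ne_zero, if_false,
    ite_self, eps_swap i j k, eps_rotate i j k]
  ring

/-- `R_{i00}^δ`. -/
theorem warpCurv_succ_zero_zero (hu : ∀ α, u α ≠ 0) (i : Fin 3) (δ : Fin 4) :
    warpCurv u u' u'' i.succ 0 0 δ = if i.succ = δ then
      1 / 4 * (u i.succ)⁻¹ * ((u 0)⁻¹ * u' 0 * u' i.succ + (u i.succ)⁻¹ * u' i.succ ^ 2
        - 2 * u'' i.succ) else 0 := by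
  have h0 := hu 0
  have hi := hu i.succ
  induction δ using Fin.cases with
  | zero =>
    simp [warpCurv, Fin.sum_univ_succ, warpSymbolDeriv, warpSymbol_succ_zero_zero,
      warpSymbol_zero_zero_succ, prodStructure_zero_mid, warpSymbol_zero_succ_zero,
      warpNum, prodStructure_zero_right]
  | succ j =>
    simp only [warpCurv, Fin.succ_ne_zero, if_false, if_true, prodStructure_zero_mid, zero_mul,
      Finset.sum_const_zero, Fin.sum_univ_succ (n := 3), warpSymbol_zero_zero_succ, mul_zero,
      warpSymbol_succ_zero_zero, warpSymbol_succ_zero_succ, warpSymbol_zero_zero_zero,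
      warpSymbolDeriv, warpSymbol_zero_succ_succ, warpNum, Fin.succ_inj,
      prodStructure_zero_left, prodStructure_zero_right, (Fin.succ_ne_zero j).symm]
    by_cases h : i = j
    · subst h
      simp
      field_simp
      ring
    · simp [h, Ne.symm h]

/-- `R_{0ij}^0`. -/
theorem warpCurv_zero_succ_succ_zero (hu : ∀ α, u α ≠ 0) (i j : Fin 3) :
    warpCurv u u' u'' 0 i.succ j.succ 0 = if i = j then
      1 / 4 * (u 0)⁻¹ * ((u 0)⁻¹ * u' 0 * u' i.succ + (u i.succ)⁻¹ * u' i.succ ^ 2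
        - 2 * u'' i.succ) else 0 := by
  have h0 := hu 0
  have hi := hu i.succ
  simp only [warpCurv, Fin.succ_ne_zero, if_false, if_true, prodStructure_zero_left, zero_mul,
    Finset.sum_const_zero, Fin.sum_univ_succ (n := 3), mul_zero,
    warpSymbol_succ_zero_zero, warpSymbol_zero_succ_zero, warpSymbol_succ_succ_zero,
    warpSymbol_zero_zero_zero,
    warpSymbolDeriv, warpSymbol_zero_succ_succ, warpNum, Fin.succ_inj,
    prodStructure_zero_mid, prodStructure_zero_right, (Fin.succ_ne_zero j).symm]
  by_cases h : i = j
  · subst h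
    simp
    field_simp
    ring
  · simp [h]

theorem warpCurv_zero_succ_zero_zero (i : Fin 3) : warpCurv u u' u'' 0 i.succ 0 0 = 0 := by
  simp [warpCurv, Fin.sum_univ_succ (n := 3), warpSymbolDeriv, warpSymbol_succ_zero_zero,
    warpSymbol_zero_zero_succ, prodStructure_zero_left, warpSymbol_zero_succ_zero,
    warpNum, prodStructure_zero_right, prodStructure_zero_mid]

theorem warpCurv_succ_zero_succ_self (i j : Fin 3) :
    warpCurv u u' u'' i.succ 0 j.succ i.succ = 0 := by
  simp only [warpCurv, Fin.sum_univ_succ (n := 3), warpSymbolDeriv,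
    warpSymbol_zero_zero_succ, warpSymbol_zero_succ_zero,
    warpSymbol_succ_zero_succ, warpSymbol_zero_succ_succ, warpSymbol_succ_succ_succ,
    warpNum_succ_succ_succ, warpSymbol_succ_succ_zero,
    prodStructure_zero_mid, Fin.succ_ne_zero, if_false, if_true,
    Fin.sum_univ_three]
  fin_cases i <;> fin_cases j <;> simp [eps]

/-- In fibre directions no derivative of a symbol enters the curvature. -/
theorem warpCurv_succ_succ (i j : Fin 3) (γ δ : Fin 4) :
    warpCurv u u' u'' i.succ j.succ γ δ
      = 2 * (∑ k, eps i j k * warpSymbol u u' k.succ γ δ)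
        + (warpSymbol u u' i.succ 0 δ * warpSymbol u u' j.succ γ 0
          - warpSymbol u u' j.succ 0 δ * warpSymbol u u' i.succ γ 0)
        + ∑ k : Fin 3, (warpSymbol u u' i.succ k.succ δ * warpSymbol u u' j.succ γ k.succ
          - warpSymbol u u' j.succ k.succ δ * warpSymbol u u' i.succ γ k.succ) := by
  simp only [warpCurv, Fin.sum_univ_succ (n := 3), prodStructure_zero_right, prodStructure_succ,
    Fin.succ_ne_zero, if_false, Fin.sum_univ_three]
  ring

theorem warpCurv_succ_succ_zero_self (i j : Fin 3) :
    warpCurv u u' u'' i.succ j.succ 0 i.succ = 0 := by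
  simp only [warpCurv_succ_succ, warpSymbol_succ_zero_succ, warpSymbol_succ_succ_succ,
    warpSymbol_succ_zero_zero, Fin.sum_univ_three]
  fin_cases i <;> fin_cases j <;> simp [eps]

theorem warpCurv_succ_succ_succ_self {i j k : Fin 3} (hjk : j ≠ k) :
    warpCurv u u' u'' i.succ j.succ k.succ i.succ = 0 := by
  simp only [warpCurv_succ_succ, warpSymbol_succ_zero_succ, warpSymbol_succ_succ_succ,
    warpSymbol_succ_succ_zero, Fin.sum_univ_three]
  fin_cases i <;> fin_cases j <;> fin_cases k <;> simp at hjk <;> simp [eps]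

theorem warpCurv_self (α γ δ : Fin 4) : warpCurv u u' u'' α α γ δ = 0 := by
  simp [warpCurv, prodStructure_eq]

theorem warpCurv_succ_succ_succ_zero {i j : Fin 3} (hij : i ≠ j) :
    warpCurv u u' u'' i.succ j.succ j.succ 0 = 0 := by
  simp only [warpCurv_succ_succ, warpSymbol_succ_succ_succ,
    warpSymbol_succ_succ_zero, warpSymbol_succ_zero_zero, Fin.sum_univ_three]
  fin_cases i <;> fin_cases j <;> simp at hij <;> simp [eps]

theorem warpCurv_distinct {i j k : Fin 3} (hij : i ≠ j) (hjk : j ≠ k) (hik : i ≠ k) :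
    warpCurv u u' u'' i.succ j.succ j.succ k.succ = 0 := by
  simp only [warpCurv_succ_succ, warpSymbol_succ_zero_succ, warpSymbol_succ_succ_succ,
    warpSymbol_succ_succ_zero, Fin.sum_univ_three]
  fin_cases i <;> fin_cases j <;> fin_cases k <;> simp at hij hjk hik <;> simp [eps]

/-- `R_{ijj}^i`. -/
theorem warpCurv_plane (hu : ∀ α, u α ≠ 0) {i j k : Fin 3} (hij : i ≠ j) (hjk : j ≠ k)
    (hik : i ≠ k) :
    warpCurv u u' u'' i.succ j.succ j.succ i.succ
      = (u i.succ)⁻¹ * (-(1 / 4) * (u 0)⁻¹ * u' j.succ * u' i.succ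
        + (-(u k.succ)⁻¹ * (u k.succ ^ 2 - (u i.succ - u j.succ) ^ 2)
          - 2 * (u k.succ - u j.succ - u i.succ))) := by
  have h0 := hu 0
  have hi := hu i.succ
  have hj := hu j.succ
  have hk := hu k.succ
  simp only [warpCurv_succ_succ, warpSymbol_succ_zero_succ, warpSymbol_succ_succ_succ,
    warpSymbol_succ_succ_zero, Fin.sum_univ_three]
  fin_cases i <;> fin_cases j <;> fin_cases k <;> simp at hij hjk hik <;> simp [eps] <;>
    simp at hi hj hk <;> field_simp <;> ring

end WarpedFormulas

/-! ### Ricci and sectional curvatures -/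

section Ricci

variable {u u' u'' : Fin 4 → ℝ}

theorem sum_fin_three {i j k : Fin 3} (hij : i ≠ j) (hjk : j ≠ k) (hik : i ≠ k) (f : Fin 3 → ℝ) :
    ∑ l, f l = f i + f j + f k := by
  rw [Fin.sum_univ_three]
  fin_cases i <;> fin_cases j <;> fin_cases k <;> simp at hij hjk hik <;> simp <;> ring

theorem warpRicci_ne (hu : ∀ α, u α ≠ 0) {β γ : Fin 4} (h : β ≠ γ) :
    ∑ α, warpCurv u u' u'' α β γ α = 0 := by
  rw [Fin.sum_univ_succ]
  induction β using Fin.cases with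
  | zero =>
    induction γ using Fin.cases with
    | zero => exact absurd rfl h
    | succ k => simp [warpCurv_self, warpCurv_succ_zero_succ_self]
  | succ j =>
    induction γ using Fin.cases with
    | zero => simp [warpCurv_zero_succ_zero_zero, warpCurv_succ_succ_zero_self]
    | succ k =>
      have hjk : j ≠ k := fun e => h (e ▸ rfl)
      simp [warpCurv_zero_succ_succ_zero hu, warpCurv_succ_succ_succ_self hjk, hjk]

theorem warpRicci_zero (hu : ∀ α, u α ≠ 0) :
    ∑ α, warpCurv u u' u'' α 0 0 α
      = 1 / 4 * ∑ i : Fin 3, ((u 0)⁻¹ * (u i.succ)⁻¹ * u' 0 * u' i.succ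
        + ((u i.succ)⁻¹ * u' i.succ) ^ 2 - 2 * (u i.succ)⁻¹ * u'' i.succ) := by
  rw [Fin.sum_univ_succ, warpCurv_self, zero_add, Finset.mul_sum]
  refine Finset.sum_congr rfl fun i _ => ?_
  rw [warpCurv_succ_zero_zero hu, if_pos rfl]
  ring

theorem warpRicci_succ (hu : ∀ α, u α ≠ 0) {i j k : Fin 3} (hij : i ≠ j) (hjk : j ≠ k)
    (hik : i ≠ k) :
    ∑ α, warpCurv u u' u'' α i.succ i.succ α
      = 1 / 4 * ((u 0)⁻¹ * ((u 0)⁻¹ * u' 0 * u' i.succ + (u i.succ)⁻¹ * u' i.succ ^ 2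
          - 2 * u'' i.succ)
        - ((u j.succ)⁻¹ * ((u 0)⁻¹ * u' j.succ * u' i.succ
            + 4 * (u k.succ)⁻¹ * (u k.succ ^ 2 - (u i.succ - u j.succ) ^ 2)
            + 8 * (u k.succ - u j.succ - u i.succ))
          + (u k.succ)⁻¹ * ((u 0)⁻¹ * u' k.succ * u' i.succ
            + 4 * (u j.succ)⁻¹ * (u j.succ ^ 2 - (u i.succ - u k.succ) ^ 2)
            + 8 * (u j.succ - u k.succ - u i.succ)))) := by
  rw [Fin.sum_univ_succ, warpCurv_zero_succ_succ_zero hu, if_pos rfl, sum_fin_three hij hjk hik,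
    warpCurv_self, warpCurv_plane hu hij.symm hik hjk, warpCurv_plane hu hik.symm hij hjk.symm]
  ring

end Ricci

section Geometry

variable (F : MilnorFrame) {φ : Circle → ℝ} {a : Fin 3 → Circle → ℝ} (x : Circle × S3)

theorem IsAnsatz.gLow_ne (h : IsAnsatz φ a) (p : Circle) (α : Fin 4) : gLow φ a α p ≠ 0 :=
  (h.gLow_pos α p).ne'

theorem IsAnsatz.ricC_ne (h : IsAnsatz φ a) {α β : Fin 4} (hαβ : α ≠ β) :
    RicC F φ a x α β = 0 := by
  rw [h.ricC_eq, warpRicci_ne (h.gLow_ne x.1) hαβ]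

theorem IsAnsatz.ricC_zero (h : IsAnsatz φ a) :
    RicC F φ a x 0 0
      = 1 / 4 * ∑ i : Fin 3, (gUp φ a 0 x.1 * gUp φ a i.succ x.1 * ddz (gLow φ a 0) x.1
            * ddz (gLow φ a i.succ) x.1
          + (gUp φ a i.succ x.1 * ddz (gLow φ a i.succ) x.1) ^ 2
          - 2 * gUp φ a i.succ x.1 * ddz (ddz (gLow φ a i.succ)) x.1) := by
  rw [h.ricC_eq, warpRicci_zero (h.gLow_ne x.1)]
  rfl

theorem IsAnsatz.ricC_succ (h : IsAnsatz φ a) {i j k : Fin 3} (hij : i ≠ j) (hjk : j ≠ k)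
    (hik : i ≠ k) :
    RicC F φ a x i.succ i.succ
      = 1 / 4 * (gUp φ a 0 x.1 * (gUp φ a 0 x.1 * ddz (gLow φ a 0) x.1 * ddz (gLow φ a i.succ) x.1
          + gUp φ a i.succ x.1 * ddz (gLow φ a i.succ) x.1 ^ 2
          - 2 * ddz (ddz (gLow φ a i.succ)) x.1)
        - (gUp φ a j.succ x.1 * (gUp φ a 0 x.1 * ddz (gLow φ a j.succ) x.1
              * ddz (gLow φ a i.succ) x.1
            + 4 * gUp φ a k.succ x.1 * (gLow φ a k.succ x.1 ^ 2
              - (gLow φ a i.succ x.1 - gLow φ a j.succ x.1) ^ 2)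
            + 8 * (gLow φ a k.succ x.1 - gLow φ a j.succ x.1 - gLow φ a i.succ x.1))
          + gUp φ a k.succ x.1 * (gUp φ a 0 x.1 * ddz (gLow φ a k.succ) x.1
              * ddz (gLow φ a i.succ) x.1
            + 4 * gUp φ a j.succ x.1 * (gLow φ a j.succ x.1 ^ 2
              - (gLow φ a i.succ x.1 - gLow φ a k.succ x.1) ^ 2)
            + 8 * (gLow φ a j.succ x.1 - gLow φ a k.succ x.1 - gLow φ a i.succ x.1)))) := by
  rw [h.ricC_eq, warpRicci_succ (h.gLow_ne x.1) hij hjk hik]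
  rfl

/-- `Rm_{i00j}`. -/
theorem IsAnsatz.rmC_succ_zero_zero_succ (h : IsAnsatz φ a) (i j : Fin 3) :
    RmC F φ a x i.succ 0 0 j.succ = if i = j then
      1 / 4 * (gUp φ a 0 x.1 * ddz (gLow φ a 0) x.1 * ddz (gLow φ a i.succ) x.1
        + gUp φ a i.succ x.1 * ddz (gLow φ a i.succ) x.1 ^ 2
        - 2 * ddz (ddz (gLow φ a i.succ)) x.1) else 0 := by
  have h0 := h.gLow_ne x.1 i.succ
  rw [h.rmC_eq, warpCurv_succ_zero_zero (h.gLow_ne x.1)]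
  by_cases hij : i = j
  · subst hij
    simp only [if_true, gUp]
    field_simp
  · simp [hij]

theorem IsAnsatz.rmC_zero_succ_succ_zero (h : IsAnsatz φ a) (i : Fin 3) :
    RmC F φ a x 0 i.succ i.succ 0
      = 1 / 4 * (gUp φ a 0 x.1 * ddz (gLow φ a 0) x.1 * ddz (gLow φ a i.succ) x.1
        + gUp φ a i.succ x.1 * ddz (gLow φ a i.succ) x.1 ^ 2
        - 2 * ddz (ddz (gLow φ a i.succ)) x.1) := by
  have h0 := h.gLow_ne x.1 0
  rw [h.rmC_eq, warpCurv_zero_succ_succ_zero (h.gLow_ne x.1), if_pos rfl]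
  simp only [gUp]
  field_simp

theorem IsAnsatz.rmHat_eq (h : IsAnsatz φ a) {i j k : Fin 3} (hij : i ≠ j) (hjk : j ≠ k)
    (hik : i ≠ k) :
    RmHat F (fun l => a l x.1) x.2 i j j i
      = -(gUp φ a k.succ x.1) * (gLow φ a k.succ x.1 ^ 2
          - (gLow φ a i.succ x.1 - gLow φ a j.succ x.1) ^ 2)
        - 2 * (gLow φ a k.succ x.1 - gLow φ a j.succ x.1 - gLow φ a i.succ x.1) :=
  _root_.rmHat_eq F (fun l => (h.pos_a l x.1).ne') x.2 hij hjk hik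

theorem IsAnsatz.rmC_plane (h : IsAnsatz φ a) {i j k : Fin 3} (hij : i ≠ j) (hjk : j ≠ k)
    (hik : i ≠ k) :
    RmC F φ a x i.succ j.succ j.succ i.succ
      = -(1 / 4) * gUp φ a 0 x.1 * ddz (gLow φ a j.succ) x.1 * ddz (gLow φ a i.succ) x.1
        + RmHat F (fun l => a l x.1) x.2 i j j i := by
  have h0 := h.gLow_ne x.1 i.succ
  rw [h.rmC_eq, warpCurv_plane (h.gLow_ne x.1) hij hjk hik, h.rmHat_eq F x hij hjk hik,
    mul_inv_cancel_left₀ h0]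
  rfl

theorem IsAnsatz.kC_zero_succ (h : IsAnsatz φ a) (i : Fin 3) :
    KC F φ a x 0 i.succ
      = 1 / 4 * gUp φ a 0 x.1 * gUp φ a i.succ x.1 * (gUp φ a 0 x.1 * ddz (gLow φ a 0) x.1
          * ddz (gLow φ a i.succ) x.1
        + gUp φ a i.succ x.1 * ddz (gLow φ a i.succ) x.1 ^ 2
        - 2 * ddz (ddz (gLow φ a i.succ)) x.1) := by
  rw [kC_eq F x φ a (Fin.succ_ne_zero i).symm, h.rmC_zero_succ_succ_zero, div_eq_mul_inv, mul_inv]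
  simp only [gUp]
  ring

theorem kHat_eq_gUp (φ : Circle → ℝ) (a : Fin 3 → Circle → ℝ) {i j : Fin 3} (hij : i ≠ j) :
    KHat F (fun l => a l x.1) x.2 i j
      = gUp φ a i.succ x.1 * gUp φ a j.succ x.1 * RmHat F (fun l => a l x.1) x.2 i j j i := by
  rw [kHat_eq F x.2 hij, div_eq_mul_inv, mul_inv, mul_comm]
  rfl

theorem IsAnsatz.kC_succ_succ (h : IsAnsatz φ a) {i j k : Fin 3} (hij : i ≠ j) (hjk : j ≠ k)
    (hik : i ≠ k) :
    KC F φ a x i.succ j.succ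
      = -(1 / 4) * gUp φ a 0 x.1 * gUp φ a i.succ x.1 * gUp φ a j.succ x.1
          * ddz (gLow φ a i.succ) x.1 * ddz (gLow φ a j.succ) x.1
        + KHat F (fun l => a l x.1) x.2 i j := by
  rw [kC_eq F x φ a (fun e => hij (Fin.succ_injective _ e)), h.rmC_plane F x hij hjk hik,
    kHat_eq_gUp F x φ a hij, div_eq_mul_inv, mul_inv]
  simp only [gUp]
  ring

theorem IsAnsatz.sigHat_eq (h : IsAnsatz φ a) (i j k : Fin 3) :
    SigHat F (fun l => a l x.1) x.2 i j k
      = eps i j k * gUp φ a k.succ x.1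
        * (gLow φ a i.succ x.1 - gLow φ a j.succ x.1 - gLow φ a k.succ x.1) :=
  _root_.sigHat_eq F (fun l => (h.pos_a l x.1).ne') x.2 i j k

end Geometry

/-! ### The Ricci flow of the ansatz -/

section ArclengthDerivative

variable {φ f : Circle → ℝ}

theorem ddz_sq (hf : ContMDiff (𝓡 1) 𝓘(ℝ, ℝ) ∞ f) (p : Circle) :
    ddz (fun p => f p ^ 2) p = 2 * f p * ddz f p :=
  ((hasDerivAt_ddz hf p).pow 2).deriv.trans (by simp)

theorem ddz_ddz_sq (hf : ContMDiff (𝓡 1) 𝓘(ℝ, ℝ) ∞ f) (p : Circle) :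
    ddz (ddz fun p => f p ^ 2) p = 2 * (ddz f p ^ 2 + f p * ddz (ddz f) p) := by
  have h : ddz (fun p => f p ^ 2) = fun p => (2 * f p) * ddz f p := funext (ddz_sq hf)
  have h2 : HasDerivAt (fun t : ℝ => (2 * f (p * Circle.exp t)) * ddz f (p * Circle.exp t))
      (2 * ddz f p * ddz f (p * Circle.exp 0) + 2 * f (p * Circle.exp 0) * ddz (ddz f) p) 0 :=
    ((hasDerivAt_ddz hf p).const_mul 2).mul (hasDerivAt_ddz (contMDiff_ddz hf) p)
  rw [h, ddz, h2.deriv]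
  simp
  ring

theorem dds_dds (hφ : ContMDiff (𝓡 1) 𝓘(ℝ, ℝ) ∞ φ) (hφ0 : ∀ p, φ p ≠ 0)
    (hf : ContMDiff (𝓡 1) 𝓘(ℝ, ℝ) ∞ f) (p : Circle) :
    dds φ (dds φ f) p = (φ p)⁻¹ * (-ddz φ p / φ p ^ 2 * ddz f p + (φ p)⁻¹ * ddz (ddz f) p) := by
  have h : HasDerivAt (fun t : ℝ => dds φ f (p * Circle.exp t))
      (-ddz φ p / φ (p * Circle.exp 0) ^ 2 * ddz f (p * Circle.exp 0)
        + (φ (p * Circle.exp 0))⁻¹ * ddz (ddz f) p) 0 :=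
    ((hasDerivAt_ddz hφ p).inv (hφ0 _)).mul (hasDerivAt_ddz (contMDiff_ddz hf) p)
  rw [dds, ddz, h.deriv]
  simp

end ArclengthDerivative

section Flow

variable (F : MilnorFrame) {J : Set ℝ} {φ : ℝ → Circle → ℝ} {a : ℝ → Fin 3 → Circle → ℝ}

/-- As the Ricci tensor is diagonal in the frame `∂_z, E_1, E_2, E_3`, the Ricci flow of the
ansatz is a system of equations for the diagonal components. -/
theorem isRicciFlowOn_iff_gLow (h : ∀ t ∈ J, IsAnsatz (φ t) (a t)) :
    IsRicciFlowOn J (fun t => ansatzMetric F (φ t) (a t)) ↔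
      ∀ t ∈ J, ∀ (x : Circle × S3) (α : Fin 4),
        HasDerivWithinAt (fun τ => gLow (φ τ) (a τ) α x.1)
          (-2 * RicC F (φ t) (a t) x α α) J t := by
  constructor
  · intro hf t ht x α
    have := hf t ht x (prodFrame F α x) (prodFrame F α x)
    simp only [ansatzMetric_prodFrame, if_true] at this
    exact this
  · intro hf t ht x v w
    have hr : -2 * ricci (ansatzMetric F (φ t) (a t)) x v w
        = ∑ α, -2 * RicC F (φ t) (a t) x α α * (prodCoframe F α x v * prodCoframe F α x w) := by
      have := (isDualFrame_prodFrame F).ricci_eq_sum_frame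
        (fun α x => gLow (φ t) (a t) α x.1) x v w
      rw [← ansatzMetric_eq_frameMetric] at this
      rw [this, Finset.mul_sum]
      refine Finset.sum_congr rfl fun α _ => ?_
      rw [Finset.sum_eq_single α _ (by simp)]
      · rw [RicC]; ring
      · intro β _ hβ
        have h0 := (h t ht).ricC_ne F x hβ.symm
        rw [RicC] at h0
        rw [h0, mul_zero]
    have hg : (fun τ => ansatzMetric F (φ τ) (a τ) x v w)
        = fun τ => ∑ α, gLow (φ τ) (a τ) α x.1 * (prodCoframe F α x v * prodCoframe F α x w) := by
      funext τ
      rw [ansatzMetric_eq_frameMetric, frameMetric_apply]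
      exact Finset.sum_congr rfl fun α _ => by ring
    rw [hr, hg]
    exact HasDerivWithinAt.fun_sum fun α _ => (hf t ht x α).mul_const _

/-- Positivity is only known at times in `J`, where it suffices. -/
theorem hasDerivWithinAt_sq_iff_log {f : ℝ → ℝ} (hf : ∀ t ∈ J, 0 < f t) {t d : ℝ} (ht : t ∈ J) :
    HasDerivWithinAt (fun τ => f τ ^ 2) (2 * f t ^ 2 * d) J t
      ↔ HasDerivWithinAt (fun τ => Real.log (f τ)) d J t := by
  have h0 := (hf t ht).ne'
  constructor
  · intro h
    refine (((h.log (pow_ne_zero 2 h0)).const_mul (1 / 2)).congr_deriv ?_).congr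
      (fun τ hτ => ?_) ?_
    · field_simp
    · rw [Real.log_pow]; push_cast; ring
    · rw [Real.log_pow]; push_cast; ring
  · intro h
    refine (((h.exp).pow 2).congr_deriv ?_).congr (fun τ hτ => ?_) ?_
    · simp only [Real.exp_log (hf t ht)]; push_cast; ring
    · simp only [Pi.pow_apply, Real.exp_log (hf τ hτ)]
    · simp only [Pi.pow_apply, Real.exp_log (hf t ht)]

theorem hasDerivWithinAt_sq_iff {f : ℝ → ℝ} (hf : ∀ t ∈ J, 0 < f t) {t d : ℝ} (ht : t ∈ J) :
    HasDerivWithinAt (fun τ => f τ ^ 2) (2 * f t * d) J t ↔ HasDerivWithinAt f d J t := by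
  have h0 := (hf t ht).ne'
  constructor
  · intro h
    refine ((h.sqrt (pow_ne_zero 2 h0)).congr_deriv ?_).congr (fun τ hτ => ?_) ?_
    · rw [Real.sqrt_sq (hf t ht).le]; field_simp
    · rw [Real.sqrt_sq (hf τ hτ).le]
    · rw [Real.sqrt_sq (hf t ht).le]
  · intro h
    refine (h.pow 2).congr_deriv ?_
    push_cast; ring

variable {φ : Circle → ℝ} {a : Fin 3 → Circle → ℝ} (x : Circle × S3)

/-- `Ric_{00}` in terms of arclength derivatives. -/
theorem IsAnsatz.ricC_zero_dds (h : IsAnsatz φ a) :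
    -2 * RicC F φ a x 0 0
      = 2 * φ x.1 ^ 2 * ∑ i : Fin 3, dds φ (dds φ (a i)) x.1 / a i x.1 := by
  have hφ := h.pos_φ x.1
  rw [h.ricC_zero, ← mul_assoc, Finset.mul_sum, Finset.mul_sum]
  refine Finset.sum_congr rfl fun i _ => ?_
  have hi := h.pos_a i x.1
  have e0 : gLow φ a 0 = fun p => φ p ^ 2 := rfl
  have ei : gLow φ a i.succ = fun p => a i p ^ 2 := rfl
  rw [dds_dds h.smooth_φ (fun p => (h.pos_φ p).ne') (h.smooth_a i)]
  simp only [gUp, e0, ei, ddz_sq h.smooth_φ, ddz_sq (h.smooth_a i), ddz_ddz_sq (h.smooth_a i)]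
  field_simp
  ring

/-- `Ric_{ii}` in terms of arclength derivatives. -/
theorem IsAnsatz.ricC_succ_dds (h : IsAnsatz φ a) {i j k : Fin 3} (hij : i ≠ j) (hjk : j ≠ k)
    (hik : i ≠ k) :
    -2 * RicC F φ a x i.succ i.succ
      = 2 * a i x.1 * (dds φ (dds φ (a i)) x.1
        + dds φ (a i) x.1 * (dds φ (a j) x.1 / a j x.1 + dds φ (a k) x.1 / a k x.1)
        - 2 * a i x.1 * ((a i x.1 ^ 4 - (a j x.1 ^ 2 - a k x.1 ^ 2) ^ 2)
          / (a i x.1 * a j x.1 * a k x.1) ^ 2)) := by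
  have hφ := h.pos_φ x.1
  have hi := h.pos_a i x.1
  have hj := h.pos_a j x.1
  have hk := h.pos_a k x.1
  have e0 : gLow φ a 0 = fun p => φ p ^ 2 := rfl
  have e : ∀ i : Fin 3, gLow φ a i.succ = fun p => a i p ^ 2 := fun _ => rfl
  rw [h.ricC_succ F x hij hjk hik,
    dds_dds h.smooth_φ (fun p => (h.pos_φ p).ne') (h.smooth_a i)]
  simp only [dds, gUp, e0, e, ddz_sq h.smooth_φ, ddz_sq (h.smooth_a _), ddz_ddz_sq (h.smooth_a i)]
  field_simp
  ring

end Flow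

/-! ### The commutator of `∂_t` and `∂_s` -/

section MixedPartials

theorem interior_nonempty_of_ordConnected {J : Set ℝ} (hJ : J.OrdConnected) (hJ' : J.Nontrivial) :
    (interior J).Nonempty := by
  obtain ⟨x, hx, y, hy, hxy⟩ := hJ'.exists_lt
  have h : Set.Ioo x y ⊆ interior J :=
    interior_maximal (Set.Ioo_subset_Icc_self.trans (hJ.out hx hy)) isOpen_Ioo
  exact (Set.nonempty_Ioo.2 hxy).mono h

/-- Mixed partial derivatives on `J × ℝ` commute, also over the end points of `J`: the set `J × ℝ`
is convex with nonempty interior, so that second derivatives within it are unique and symmetric. -/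
theorem hasDerivWithinAt_deriv_comm {J : Set ℝ} (hJ : J.OrdConnected) (hJ' : J.Nontrivial)
    {f : ℝ × ℝ → ℝ} (hf : ContDiffOn ℝ ∞ f (J ×ˢ Set.univ)) {t : ℝ} (ht : t ∈ J) (s : ℝ) :
    HasDerivWithinAt (fun τ => deriv (fun σ => f (τ, σ)) s)
      (deriv (fun σ => derivWithin (fun τ => f (τ, σ)) J t) s) J t := by
  set S : Set (ℝ × ℝ) := J ×ˢ Set.univ with hS
  have hi := interior_nonempty_of_ordConnected hJ hJ'
  have hSi : (interior S).Nonempty := by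
    rw [hS, interior_prod_eq, interior_univ]
    exact hi.prod Set.univ_nonempty
  have hSc : Convex ℝ S := hJ.convex.prod convex_univ
  have hSu : UniqueDiffOn ℝ S := uniqueDiffOn_convex hSc hSi
  have hJu : UniqueDiffOn ℝ J := uniqueDiffOn_convex hJ.convex hi
  have hmem : ∀ {τ : ℝ} (σ : ℝ), τ ∈ J → (τ, σ) ∈ S := fun σ hτ => ⟨hτ, Set.mem_univ σ⟩
  have h1 : ∀ x ∈ S, HasFDerivWithinAt f (fderivWithin ℝ f S x) S x :=
    fun x hx => ((hf x hx).differentiableWithinAt (by simp)).hasFDerivWithinAt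
  have h2 : HasFDerivWithinAt (fderivWithin ℝ f S) (fderivWithin ℝ (fderivWithin ℝ f S) S (t, s))
      S (t, s) :=
    (((hf.fderivWithin hSu (m := ∞) le_rfl) _ (hmem s ht)).differentiableWithinAt
      (by simp)).hasFDerivWithinAt
  -- the two slices of a function on `S`
  have sl1 : ∀ {V : Type} [NormedAddCommGroup V] [NormedSpace ℝ V] {g : ℝ × ℝ → V}
      {g' : ℝ × ℝ →L[ℝ] V} {τ σ : ℝ}, HasFDerivWithinAt g g' S (τ, σ) →
      HasDerivWithinAt (fun τ => g (τ, σ)) (g' (1, 0)) J τ := by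
    intro V _ _ g g' τ σ hg
    exact hg.comp_hasDerivWithinAt τ
      ((hasDerivAt_id τ).prodMk (hasDerivAt_const τ σ)).hasDerivWithinAt (fun x hx => hmem σ hx)
  have sl2 : ∀ {V : Type} [NormedAddCommGroup V] [NormedSpace ℝ V] {g : ℝ × ℝ → V}
      {g' : ℝ × ℝ →L[ℝ] V} {τ σ : ℝ}, τ ∈ J → HasFDerivWithinAt g g' S (τ, σ) →
      HasDerivAt (fun σ => g (τ, σ)) (g' (0, 1)) σ := by
    intro V _ _ g g' τ σ hτ hg
    rw [← hasDerivWithinAt_univ]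
    exact hg.comp_hasDerivWithinAt σ
      ((hasDerivAt_const σ τ).prodMk (hasDerivAt_id σ)).hasDerivWithinAt (fun x _ => hmem x hτ)
  have e1 : ∀ τ ∈ J, deriv (fun σ => f (τ, σ)) s = fderivWithin ℝ f S (τ, s) (0, 1) :=
    fun τ hτ => (sl2 hτ (h1 _ (hmem s hτ))).deriv
  have e2 : (fun σ => derivWithin (fun τ => f (τ, σ)) J t)
      = fun σ => fderivWithin ℝ f S (t, σ) (1, 0) :=
    funext fun σ => (sl1 (h1 _ (hmem σ ht))).derivWithin (hJu t ht)
  have e3 : deriv (fun σ => fderivWithin ℝ f S (t, σ) (1, 0)) s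
      = fderivWithin ℝ (fderivWithin ℝ f S) S (t, s) (0, 1) (1, 0) :=
    ((sl2 ht h2).clm_apply (hasDerivAt_const s ((1, 0) : ℝ × ℝ))).deriv.trans (by simp)
  have hsymm : fderivWithin ℝ (fderivWithin ℝ f S) S (t, s) (0, 1) (1, 0)
      = fderivWithin ℝ (fderivWithin ℝ f S) S (t, s) (1, 0) (0, 1) := by
    refine (hf _ (hmem s ht)).isSymmSndFDerivWithinAt
      (by simpa using WithTop.coe_le_coe.2 (le_top : (2 : ℕ∞) ≤ ⊤)) hSu ?_ (hmem s ht) _ _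
    rw [hSc.closure_interior_eq_closure_of_nonempty_interior hSi]
    exact subset_closure (hmem s ht)
  rw [e2, e3, hsymm]
  refine (((sl1 h2).clm_apply
    (hasDerivWithinAt_const t J ((0, 1) : ℝ × ℝ))).congr_deriv (by simp)).congr e1 (e1 t ht)

/-- `∂_t ∂_z f = ∂_z ∂_t f` on `J × S¹`. -/
theorem hasDerivWithinAt_ddz {J : Set ℝ} (hJ : J.OrdConnected) (hJ' : J.Nontrivial)
    {f : ℝ → Circle → ℝ}
    (hf : ContMDiffOn (𝓘(ℝ, ℝ).prod (𝓡 1)) 𝓘(ℝ, ℝ) ∞ (Function.uncurry f) (J ×ˢ Set.univ))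
    {t : ℝ} (ht : t ∈ J) (p : Circle) :
    HasDerivWithinAt (fun τ => ddz (f τ) p) (ddz (ddt J f t) p) J t := by
  have hm : ContMDiff 𝓘(ℝ, ℝ × ℝ) (𝓘(ℝ, ℝ).prod (𝓡 1)) ∞
      (fun x : ℝ × ℝ => (x.1, p * Circle.exp x.2)) :=
    contDiff_fst.contMDiff.prodMk
      (contMDiff_const.mul (contMDiff_circleExp.comp contDiff_snd.contMDiff))
  have h : ContMDiffOn 𝓘(ℝ, ℝ × ℝ) 𝓘(ℝ, ℝ) ∞ (fun x : ℝ × ℝ => f x.1 (p * Circle.exp x.2))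
      (J ×ˢ Set.univ) :=
    hf.comp hm.contMDiffOn fun x hx => ⟨hx.1, Set.mem_univ _⟩
  exact hasDerivWithinAt_deriv_comm hJ hJ' h.contDiffOn ht 0

end MixedPartials

/-! ### The flow equations -/

section FlowEquations

variable (F : MilnorFrame) {J : Set ℝ} {φ : ℝ → Circle → ℝ} {a : ℝ → Fin 3 → Circle → ℝ}

theorem isRicciFlowOn_iff (h : ∀ t ∈ J, IsAnsatz (φ t) (a t)) :
    IsRicciFlowOn J (fun t => ansatzMetric F (φ t) (a t)) ↔
      ∀ t ∈ J, ∀ p : Circle,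
        HasDerivWithinAt (fun τ => Real.log (φ τ p))
          (∑ i : Fin 3, dds (φ t) (dds (φ t) (a t i)) p / a t i p) J t ∧
        ∀ i j k : Fin 3, i ≠ j → j ≠ k → i ≠ k →
          HasDerivWithinAt (fun τ => a τ i p)
            (dds (φ t) (dds (φ t) (a t i)) p
              + dds (φ t) (a t i) p
                * (dds (φ t) (a t j) p / a t j p + dds (φ t) (a t k) p / a t k p)
              - 2 * a t i p * ((a t i p ^ 4 - (a t j p ^ 2 - a t k p ^ 2) ^ 2)
                / (a t i p * a t j p * a t k p) ^ 2)) J t := by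
  rw [isRicciFlowOn_iff_gLow F h]
  have hφ : ∀ p, ∀ t ∈ J, 0 < φ t p := fun p t ht => (h t ht).pos_φ p
  have ha : ∀ i p, ∀ t ∈ J, 0 < a t i p := fun i p t ht => (h t ht).pos_a i p
  constructor
  · intro hf t ht p
    -- the equations do not involve the point of the fibre
    have q : S3 := ⟨1, by simp⟩
    refine ⟨?_, fun i j k hij hjk hik => ?_⟩
    · have h0 := hf t ht (p, q) 0
      rw [(h t ht).ricC_zero_dds] at h0
      exact (hasDerivWithinAt_sq_iff_log (hφ p) ht).1 h0
    · have hi := hf t ht (p, q) i.succ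
      rw [(h t ht).ricC_succ_dds F (p, q) hij hjk hik] at hi
      exact (hasDerivWithinAt_sq_iff (ha i p) ht).1 hi
  · intro hf t ht x α
    induction α using Fin.cases with
    | zero =>
      rw [(h t ht).ricC_zero_dds]
      exact (hasDerivWithinAt_sq_iff_log (hφ x.1) ht).2 (hf t ht x.1).1
    | succ i =>
      obtain ⟨j, k, hij, hjk, hik⟩ : ∃ j k : Fin 3, i ≠ j ∧ j ≠ k ∧ i ≠ k := by
        fin_cases i
        exacts [⟨1, 2, by decide⟩, ⟨0, 2, by decide⟩, ⟨0, 1, by decide⟩]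
      rw [(h t ht).ricC_succ_dds F x hij hjk hik]
      exact (hasDerivWithinAt_sq_iff (ha i x.1) ht).2 ((hf t ht x.1).2 i j k hij hjk hik)

/-- The commutator of `∂_t` and `∂_s` is determined by the evolution of `log φ` alone. -/
theorem commutator_ddt_dds (hJ : J.OrdConnected) (hJ' : J.Nontrivial) {t l : ℝ} {p : Circle}
    (ht : t ∈ J) (hφ : ∀ t ∈ J, 0 < φ t p)
    (hlog : HasDerivWithinAt (fun τ => Real.log (φ τ p)) l J t) {f : ℝ → Circle → ℝ}
    (hf : ContMDiffOn (𝓘(ℝ, ℝ).prod (𝓡 1)) 𝓘(ℝ, ℝ) ∞ (Function.uncurry f) (J ×ˢ Set.univ)) :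
    ddt J (fun τ => dds (φ τ) (f τ)) t p - dds (φ t) (ddt J f t) p = -l * dds (φ t) (f t) p := by
  have h0 := (hφ t ht).ne'
  have hJu : UniqueDiffWithinAt ℝ J t :=
    uniqueDiffOn_convex hJ.convex (interior_nonempty_of_ordConnected hJ hJ') t ht
  have h1 : HasDerivWithinAt (fun τ => φ τ p) (φ t p * l) J t :=
    (hlog.exp.congr_deriv (by rw [Real.exp_log (hφ t ht)])).congr
      (fun τ hτ => (Real.exp_log (hφ τ hτ)).symm) (Real.exp_log (hφ t ht)).symm
  have h2 := ((h1.inv h0).mul (hasDerivWithinAt_ddz hJ hJ' hf ht p)).derivWithin hJu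
  have h3 : ddt J (fun τ => dds (φ τ) (f τ)) t p
      = -(φ t p * l) / φ t p ^ 2 * ddz (f t) p + (φ t p)⁻¹ * ddz (ddt J f t) p := h2
  rw [h3]
  simp only [dds]
  field_simp
  ring

end FlowEquations

end

theorem mainTheorem11 :
    -- the frames of `S³` in question exist: `q ↦ -q e_i`, with `e_i` the imaginary units, is one
    (∃ F : MilnorFrame, ∀ (i : Fin 3) (q : S3),
      mvfderiv (𝓡 3) (fun y : S3 => (y : Quaternion ℝ)) q (F.frame i q)
        = -((q : Quaternion ℝ) * imUnit i)) ∧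
    -- computation of the geometry of the metric
    (∀ (F : MilnorFrame) (φ : Circle → ℝ) (a : Fin 3 → Circle → ℝ), IsAnsatz φ a →
      -- Levi-Civita connections and curvature tensors exist
      IsLeviCivita (ansatzMetric F φ a) (leviCivita (ansatzMetric F φ a)) ∧
      IsCurvatureTensor (leviCivita (ansatzMetric F φ a)) (curvature (ansatzMetric F φ a)) ∧
      (∀ p : Circle,
        IsLeviCivita (fibreMetric F fun i => a i p) (leviCivita (fibreMetric F fun i => a i p)) ∧
        IsCurvatureTensor (leviCivita (fibreMetric F fun i => a i p))
          (curvature (fibreMetric F fun i => a i p))) ∧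
      ∀ (p : Circle) (q : S3),
        -- the frame, its dual coframe, and the metric components
        (∀ α β, prodCoframe F α (p, q) (prodFrame F β (p, q)) = if α = β then 1 else 0) ∧
        (∀ α β, ansatzMetric F φ a (p, q) (prodFrame F α (p, q)) (prodFrame F β (p, q))
          = if α = β then gLow φ a α p else 0) ∧
        -- frame symbols
        Sig F φ a (p, q) 0 0 0 = 1 / 2 * gUp φ a 0 p * ddz (gLow φ a 0) p ∧
        (∀ i : Fin 3, Sig F φ a (p, q) 0 i.succ 0 = 0 ∧ Sig F φ a (p, q) i.succ 0 0 = 0 ∧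
          Sig F φ a (p, q) 0 0 i.succ = 0) ∧
        (∀ i j : Fin 3,
          Sig F φ a (p, q) j.succ 0 i.succ
            = (if i = j then 1 / 2 * gUp φ a i.succ p * ddz (gLow φ a i.succ) p else 0) ∧
          Sig F φ a (p, q) 0 j.succ i.succ
            = (if i = j then 1 / 2 * gUp φ a i.succ p * ddz (gLow φ a i.succ) p else 0) ∧
          Sig F φ a (p, q) i.succ j.succ 0
            = (if i = j then -(1 / 2) * gUp φ a 0 p * ddz (gLow φ a i.succ) p else 0)) ∧
        (∀ i j k : Fin 3,
          Sig F φ a (p, q) i.succ j.succ k.succ = SigHat F (fun l => a l p) q i j k ∧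
          SigHat F (fun l => a l p) q i j k
            = eps i j k * gUp φ a k.succ p * (gLow φ a i.succ p - gLow φ a j.succ p - gLow φ a k.succ p)) ∧
        -- Riemann curvature components
        RmC F φ a (p, q) 0 0 0 0 = 0 ∧
        (∀ i : Fin 3, RmC F φ a (p, q) 0 0 0 i.succ = 0 ∧
          RmC F φ a (p, q) i.succ 0 0 i.succ
            = 1 / 4 * (gUp φ a 0 p * ddz (gLow φ a 0) p * ddz (gLow φ a i.succ) p
              + gUp φ a i.succ p * ddz (gLow φ a i.succ) p ^ 2 - 2 * ddz (ddz (gLow φ a i.succ)) p) ∧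
          RmC F φ a (p, q) 0 i.succ i.succ 0
            = 1 / 4 * (gUp φ a 0 p * ddz (gLow φ a 0) p * ddz (gLow φ a i.succ) p
              + gUp φ a i.succ p * ddz (gLow φ a i.succ) p ^ 2 - 2 * ddz (ddz (gLow φ a i.succ)) p)) ∧
        (∀ i j : Fin 3, i ≠ j → RmC F φ a (p, q) i.succ 0 0 j.succ = 0) ∧
        (∀ i j k : Fin 3, i ≠ j → j ≠ k → i ≠ k →
          RmC F φ a (p, q) i.succ j.succ j.succ k.succ = 0 ∧
          RmC F φ a (p, q) i.succ j.succ j.succ 0 = 0 ∧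
          RmC F φ a (p, q) i.succ j.succ j.succ i.succ
            = -(1 / 4) * gUp φ a 0 p * ddz (gLow φ a j.succ) p * ddz (gLow φ a i.succ) p + RmHat F (fun l => a l p) q i j j i ∧
          RmHat F (fun l => a l p) q i j j i
            = -(gUp φ a k.succ p) * (gLow φ a k.succ p ^ 2 - (gLow φ a i.succ p - gLow φ a j.succ p) ^ 2)
              - 2 * (gLow φ a k.succ p - gLow φ a j.succ p - gLow φ a i.succ p)) ∧
        -- Ricci components
        (∀ α β : Fin 4, α ≠ β → RicC F φ a (p, q) α β = 0) ∧
        RicC F φ a (p, q) 0 0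
          = 1 / 4 * ∑ i : Fin 3, (gUp φ a 0 p * gUp φ a i.succ p * ddz (gLow φ a 0) p * ddz (gLow φ a i.succ) p
            + (gUp φ a i.succ p * ddz (gLow φ a i.succ) p) ^ 2 - 2 * gUp φ a i.succ p * ddz (ddz (gLow φ a i.succ)) p) ∧
        (∀ i j k : Fin 3, i ≠ j → j ≠ k → i ≠ k →
          RicC F φ a (p, q) i.succ i.succ
            = 1 / 4 * (gUp φ a 0 p * (gUp φ a 0 p * ddz (gLow φ a 0) p * ddz (gLow φ a i.succ) p
                + gUp φ a i.succ p * ddz (gLow φ a i.succ) p ^ 2 - 2 * ddz (ddz (gLow φ a i.succ)) p)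
              - (gUp φ a j.succ p * (gUp φ a 0 p * ddz (gLow φ a j.succ) p * ddz (gLow φ a i.succ) p
                  + 4 * gUp φ a k.succ p * (gLow φ a k.succ p ^ 2 - (gLow φ a i.succ p - gLow φ a j.succ p) ^ 2)
                  + 8 * (gLow φ a k.succ p - gLow φ a j.succ p - gLow φ a i.succ p))
                + gUp φ a k.succ p * (gUp φ a 0 p * ddz (gLow φ a k.succ) p * ddz (gLow φ a i.succ) p
                  + 4 * gUp φ a j.succ p * (gLow φ a j.succ p ^ 2 - (gLow φ a i.succ p - gLow φ a k.succ p) ^ 2)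
                  + 8 * (gLow φ a j.succ p - gLow φ a k.succ p - gLow φ a i.succ p))))) ∧
        -- sectional curvatures
        (∀ i : Fin 3, KC F φ a (p, q) 0 i.succ
          = 1 / 4 * gUp φ a 0 p * gUp φ a i.succ p * (gUp φ a 0 p * ddz (gLow φ a 0) p * ddz (gLow φ a i.succ) p
            + gUp φ a i.succ p * ddz (gLow φ a i.succ) p ^ 2 - 2 * ddz (ddz (gLow φ a i.succ)) p)) ∧
        (∀ i j k : Fin 3, i ≠ j → j ≠ k → i ≠ k →
          KC F φ a (p, q) i.succ j.succ
            = -(1 / 4) * gUp φ a 0 p * gUp φ a i.succ p * gUp φ a j.succ p * ddz (gLow φ a i.succ) p * ddz (gLow φ a j.succ) p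
              + KHat F (fun l => a l p) q i j ∧
          KHat F (fun l => a l p) q i j
            = -(gUp φ a i.succ p * gUp φ a j.succ p
              * (gUp φ a k.succ p * (gLow φ a k.succ p ^ 2 - (gLow φ a i.succ p - gLow φ a j.succ p) ^ 2)
                + 2 * (gLow φ a k.succ p - gLow φ a j.succ p - gLow φ a i.succ p))))) ∧
    -- the Ricci flow
    (∀ (F : MilnorFrame) (J : Set ℝ), J.OrdConnected → J.Nontrivial →
      ∀ (φ : ℝ → Circle → ℝ) (a : ℝ → Fin 3 → Circle → ℝ), (∀ t ∈ J, IsAnsatz (φ t) (a t)) →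
      -- the flow is equivalent to the system of equations, where `' = ∂_s = φ⁻¹ ∂_z`
      (IsRicciFlowOn J (fun t => ansatzMetric F (φ t) (a t)) ↔
        ∀ t ∈ J, ∀ p : Circle,
          HasDerivWithinAt (fun τ => Real.log (φ τ p))
            (∑ i : Fin 3, dds (φ t) (dds (φ t) (a t i)) p / a t i p) J t ∧
          ∀ i j k : Fin 3, i ≠ j → j ≠ k → i ≠ k →
            HasDerivWithinAt (fun τ => a τ i p)
              (dds (φ t) (dds (φ t) (a t i)) p
                + dds (φ t) (a t i) p
                  * (dds (φ t) (a t j) p / a t j p + dds (φ t) (a t k) p / a t k p)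
                - 2 * a t i p * ((a t i p ^ 4 - (a t j p ^ 2 - a t k p ^ 2) ^ 2)
                  / (a t i p * a t j p * a t k p) ^ 2)) J t) ∧
      -- the commutator of `∂_t` and `∂_s` along the flow
      (IsRicciFlowOn J (fun t => ansatzMetric F (φ t) (a t)) →
        ∀ f : ℝ → Circle → ℝ,
          ContMDiffOn (𝓘(ℝ, ℝ).prod (𝓡 1)) 𝓘(ℝ, ℝ) ∞ (Function.uncurry f) (J ×ˢ Set.univ) →
          ∀ t ∈ J, ∀ p : Circle,
            ddt J (fun τ => dds (φ τ) (f τ)) t p - dds (φ t) (ddt J f t) p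
              = -(∑ i : Fin 3, dds (φ t) (dds (φ t) (a t i)) p / a t i p)
                * dds (φ t) (f t) p)) := by
  refine ⟨⟨sphereFrame, mvfderiv_coe_sphereField⟩, ?_, ?_⟩
  · intro F φ a h
    refine ⟨h.isLeviCivita F, h.isCurvatureTensor F, fun p =>
      ⟨isLeviCivita_fibreMetric F fun i => (h.pos_a i p).ne',
        isCurvatureTensor_fibreMetric F fun i => (h.pos_a i p).ne'⟩, fun p q => ?_⟩
    refine ⟨fun α β => prodCoframe_prodFrame F α β (p, q),
      ansatzMetric_prodFrame F (p, q) φ a, ?_, fun i => ⟨?_, ?_, ?_⟩, fun i j => ⟨?_, ?_, ?_⟩,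
      fun i j k => ⟨?_, h.sigHat_eq F (p, q) i j k⟩, ?_, fun i => ⟨?_, ?_,
      h.rmC_zero_succ_succ_zero F (p, q) i⟩, fun i j hij => ?_,
      fun i j k hij hjk hik => ⟨?_, ?_, h.rmC_plane F (p, q) hij hjk hik,
        h.rmHat_eq F (p, q) hij hjk hik⟩,
      fun α β hαβ => h.ricC_ne F (p, q) hαβ, h.ricC_zero F (p, q),
      fun i j k hij hjk hik => h.ricC_succ F (p, q) hij hjk hik, h.kC_zero_succ F (p, q),
      fun i j k hij hjk hik => ⟨h.kC_succ_succ F (p, q) hij hjk hik, ?_⟩⟩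
    · rw [h.sig_eq, warpSymbol_zero_zero_zero]; rfl
    · rw [h.sig_eq, warpSymbol_zero_succ_zero]
    · rw [h.sig_eq, warpSymbol_succ_zero_zero]
    · rw [h.sig_eq, warpSymbol_zero_zero_succ]
    · rw [h.sig_eq, warpSymbol_succ_zero_succ]; rfl
    · rw [h.sig_eq, warpSymbol_zero_succ_succ]; rfl
    · rw [h.sig_eq, warpSymbol_succ_succ_zero]; rfl
    · rw [h.sig_eq, warpSymbol_succ_succ_succ, h.sigHat_eq F (p, q)]; rfl
    · rw [h.rmC_eq, warpCurv_self, mul_zero]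
    · rw [h.rmC_eq, warpCurv_self, mul_zero]
    · rw [h.rmC_succ_zero_zero_succ, if_pos rfl]
    · rw [h.rmC_succ_zero_zero_succ, if_neg hij]
    · rw [h.rmC_eq, warpCurv_distinct hij hjk hik, mul_zero]
    · rw [h.rmC_eq, warpCurv_succ_succ_succ_zero hij, mul_zero]
    · rw [kHat_eq_gUp F (p, q) φ a hij, h.rmHat_eq F (p, q) hij hjk hik]
      ring
  · intro F J hJ hJ' φ a h
    refine ⟨isRicciFlowOn_iff F h, fun hflow f hf t ht p => ?_⟩
    exact commutator_ddt_dds hJ hJ' ht (fun τ hτ => (h τ hτ).pos_φ p)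
      ((isRicciFlowOn_iff F h).1 hflow t ht p).1 hf
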